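/- **Lemma 4.1 (quotient in stages).** Let $G$ be a Lie group acting smoothly on a manifold $N$, and let $K$ be a normal subgroup of $G$ that is a Lie subgroup, i.e. the image of an injective Lie group homomorphism $\iota\colon L\to G$ (not necessarily closed; $K$ carries the Lie group structure of $L$). Lie groups and manifolds are finite-dimensional, Hausdorff and second countable. Let $G$ act on $N/K$ by $g\cdot[x]=[g\cdot x]$, let $\pi_K\colon N\to N/K$, $\pi_G\colon N\to N/G$ and $\pi_{G/K}\colon N/K\to (N/K)/G$ be the quotient maps, and equip $N$ with its standard diffeology and all quotients with the quotient diffeologies. For a diffeological space $X$, $\Omega^k(X)$ denotes the diffeological differential $k$-forms on $X$. (i) There is a unique map $e\colon N/G\to (N/K)/G$ with $e\circ\pi_G=\pi_{G/K}\circ\pi_K$. (ii) The map $e$ is a diffeomorphism of diffeological spaces. (iii) For every $k\ge 0$, the pullback $\pi_K^*\colon\Omega^k(N/K)\to\Omega^k(N)$ restricts to a bijection from the image of $\pi_{G/K}^*\colon \Omega^k((N/K)/G)\to\Omega^k(N/K)$ onto the image of $\pi_G^*\colon\Omega^k(N/G)\to\Omega^k(N)$. (iv) Suppose that $K$ acts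 properly on $N$ (that is, $(l,x)\mapsto(x,\iota(l)\cdot x)$ is a proper map $L\times N\to N\times N$) and with constant orbit-type (all stabilisers in $K$ of points of $N$ are conjugate in $K$). Then for every $k\ge0$, $\pi_K^*$ also restricts to a bijection from $\Omega^k_{\mathrm{basic}}(N/K)$ onto $\Omega^k_{\mathrm{basic}}(N)$. Consequently, $\operatorname{im}\pi_{G/K}^*=\Omega^k_{\mathrm{basic}}(N/K)$ if and only if $\operatorname{im}\pi_G^*=\Omega^k_{\mathrm{basic}}(N)$. Here, for $X=N$ or $X=N/K$, $\Omega^k_{\mathrm{basic}}(X)$ is the set of $\alpha\in\Omega^k(X)$ that are $G$-invariant ($g^*\alpha=\alpha$ for all $g\in G$) and horizontal. Horizontal means that $\alpha$ vanishes when one of its arguments is tangent to a $G$-orbit: for every plot $p$ of $X$, point $u$ and vector $w$ for which there is a smooth curve $g$ in $G$ with $g(0)=1$ and $p(u+tw)=g(t)\cdot p(u)$ for all $t$ near $0$, one has $\alpha(p)_u(w,\cdot,\dots,\cdot)=0$. On a manifold this is the usual condition $\alpha_x(v,\cdot,\dots,\cdot)=0$ for all $x$ and all $v\in T_x(G\cdot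 x)$. -/

import Mathlib

open Diffeology
open scoped Manifold ContDiff Topology

noncomputable section

namespace QuotientInStages

/-- The Euclidean space `ℝⁿ`. -/
abbrev Euc (n : ℕ) : Type := EuclideanSpace ℝ (Fin n)

/-- A smooth map of `ℝⁿ` into a given open set that is the identity near a given point of it.
It turns a plot defined near the point into a plot defined on all of `ℝⁿ` with the same germ. -/
theorem exists_cutoff {n : ℕ} {u : Set (Euc n)} {x : Euc n} (hu : u ∈ 𝓝 x) :
    ∃ f : Euc n → Euc n, ContDiff ℝ ∞ f ∧ (∀ y, f y ∈ u) ∧ f =ᶠ[𝓝 x] id := by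
  obtain ⟨ε, hε, hball⟩ := Metric.mem_nhds_iff.1 hu
  let b : ContDiffBump x := ⟨ε / 2, ε, by positivity, by linarith⟩
  refine ⟨fun y => x + b y • (y - x),
    contDiff_const.add (b.contDiff.smul (contDiff_id.sub contDiff_const)), fun y => hball ?_, ?_⟩
  · by_cases hy : dist y x < ε
    · rw [Metric.mem_ball, dist_eq_norm, add_sub_cancel_left, norm_smul,
        Real.norm_of_nonneg b.nonneg, ← dist_eq_norm]
      exact lt_of_le_of_lt (mul_le_of_le_one_left dist_nonneg b.le_one) hy
    · have hy0 : b y = 0 := b.zero_of_le_dist (not_lt.1 hy)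
      simpa [hy0] using hε
  · filter_upwards [b.eventuallyEq_one] with y hy
    simp [hy]

/-! ### Diffeologies -/

/-- The diffeology of `M` is the standard diffeology of a manifold modelled on the normed
space `E`: the plots are exactly the smooth maps `ℝⁿ → M`. -/
class IsManifoldDiffeology (E : Type*) [NormedAddCommGroup E] [NormedSpace ℝ E]
    (M : Type*) [TopologicalSpace M] [ChartedSpace E M] [DiffeologicalSpace M] : Prop where
  isPlot_iff {n : ℕ} {p : Euc n → M} : IsPlot p ↔ ContMDiff 𝓘(ℝ, Euc n) 𝓘(ℝ, E) ∞ p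

/-- The standard diffeology of a manifold. -/
@[reducible]
def manifoldDiffeology (E : Type*) [NormedAddCommGroup E] [NormedSpace ℝ E]
    (M : Type*) [TopologicalSpace M] [ChartedSpace E M] : DiffeologicalSpace M where
  plots n := {p | ContMDiff 𝓘(ℝ, Euc n) 𝓘(ℝ, E) ∞ p}
  constant_plots _ := contMDiff_const
  plot_reparam hp hf := ContMDiff.comp hp hf.contMDiff
  locality {n p} h := by
    intro x
    obtain ⟨u, hu, hxu, H⟩ := h x
    obtain ⟨f, hf, hfu, hfx⟩ := exists_cutoff (hu.mem_nhds hxu)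
    refine ((H hfu hf : ContMDiff _ _ _ _) x).congr_of_eventuallyEq ?_
    filter_upwards [hfx] with y hy
    simp [hy]

theorem isManifoldDiffeology_manifoldDiffeology (E : Type*) [NormedAddCommGroup E]
    [NormedSpace ℝ E] (M : Type*) [TopologicalSpace M] [ChartedSpace E M] :
    @IsManifoldDiffeology E _ _ M _ _ (manifoldDiffeology E M) :=
  letI := manifoldDiffeology E M
  ⟨Iff.rfl⟩

/-- The quotient diffeology: the plots are the maps that lift, locally on their domain, to
plots upstairs. (A plot defined near a point has the same germ there as a plot defined on
all of `ℝⁿ`, see `exists_cutoff`; so the local lifts may be taken to be global.) -/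
instance quotientDiffeology {X : Type*} [DiffeologicalSpace X] (s : Setoid X) :
    DiffeologicalSpace (Quotient s) where
  plots n := {p | ∀ x : Euc n, ∃ q : Euc n → X, IsPlot q ∧
    ∃ v : Set (Euc n), IsOpen v ∧ x ∈ v ∧ ∀ y ∈ v, p y = Quotient.mk s (q y)}
  constant_plots {n} c x := by
    obtain ⟨a, rfl⟩ := Quotient.exists_rep c
    exact ⟨fun _ => a, isPlot_const, Set.univ, isOpen_univ, trivial, fun _ _ => rfl⟩
  plot_reparam {n m p f} hp hf x := by
    obtain ⟨q, hq, v, hv, hxv, H⟩ := hp (f x)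
    exact ⟨q ∘ f, isPlot_reparam hq hf, f ⁻¹' v, hv.preimage hf.continuous, hxv,
      fun y hy => H (f y) hy⟩
  locality {n p} h x := by
    obtain ⟨u, hu, hxu, H⟩ := h x
    obtain ⟨f, hf, hfu, hfx⟩ := exists_cutoff (hu.mem_nhds hxu)
    obtain ⟨q, hq, v, hv, hxv, Hq⟩ := H hfu hf x
    obtain ⟨w, hw, hwo, hxw⟩ := mem_nhds_iff.1 hfx
    refine ⟨q, hq, v ∩ w, hv.inter hwo, ⟨hxv, hxw⟩, fun y hy => ?_⟩
    have h1 : f y = y := hw hy.2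
    have h2 := Hq y hy.1
    simpa [h1] using h2

/-- A diffeomorphism of diffeological spaces: a smooth map with a smooth two-sided inverse. -/
def IsDDiffeomorphism {X Y : Type*} [DiffeologicalSpace X] [DiffeologicalSpace Y]
    (f : X → Y) : Prop :=
  DSmooth f ∧ ∃ g : Y → X, DSmooth g ∧ Function.LeftInverse g f ∧ Function.RightInverse g f

/-! ### Orbit spaces -/

/-- The quotient map `X → X / H` of a group action. -/
def orbitProj (H X : Type*) [Group H] [MulAction H X] : X → MulAction.orbitRel.Quotient H X :=
  Quotient.mk (MulAction.orbitRel H X)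

theorem dSmooth_orbitProj (H X : Type*) [Group H] [MulAction H X] [DiffeologicalSpace X] :
    DSmooth (orbitProj H X) := fun _ p hp _ =>
  ⟨p, hp, Set.univ, isOpen_univ, trivial, fun _ _ => rfl⟩

/-- The action of `G` on `N / K` induced by an action on `N`, for `K` normal in `G`:
`g • [x] = [g • x]`. -/
instance orbitSpaceAction {G N : Type*} [Group G] [MulAction G N] (K : Subgroup G) [K.Normal] :
    MulAction G (MulAction.orbitRel.Quotient K N) where
  smul g := Quotient.map (fun x => g • x) (by
    rintro a b ⟨k, rfl⟩
    refine ⟨⟨g * k * g⁻¹, Subgroup.Normal.conj_mem inferInstance _ k.2 g⟩, ?_⟩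
    simp [Subgroup.smul_def, mul_smul])
  one_smul y := by
    obtain ⟨x, rfl⟩ := Quotient.exists_rep y
    exact congrArg (Quotient.mk _) (one_smul G x)
  mul_smul g h y := by
    obtain ⟨x, rfl⟩ := Quotient.exists_rep y
    exact congrArg (Quotient.mk _) (mul_smul g h x)

theorem smul_orbitProj {G N : Type*} [Group G] [MulAction G N] (K : Subgroup G) [K.Normal]
    (g : G) (x : N) : g • orbitProj K N x = orbitProj K N (g • x) := rfl

/-! ### Differential forms -/

/-- A diffeological differential `k`-form on `X`: an assignment of a smooth `k`-form on `ℝⁿ` to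
each plot `ℝⁿ → X`, compatible with smooth reparametrisations. -/
@[ext]
structure DForm (X : Type*) [DiffeologicalSpace X] (k : ℕ) where
  toFun : ∀ {n : ℕ} (p : Euc n → X), IsPlot p → Euc n → (Euc n) [⋀^Fin k]→L[ℝ] ℝ
  smooth : ∀ {n : ℕ} (p : Euc n → X) (hp : IsPlot p), ContDiff ℝ ∞ (toFun p hp)
  compat : ∀ {n m : ℕ} (p : Euc n → X) (hp : IsPlot p) (F : Euc m → Euc n)
    (hF : ContDiff ℝ ∞ F) (x : Euc m),
    toFun (p ∘ F) (isPlot_reparam hp hF) x =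
      (toFun p hp (F x)).compContinuousLinearMap (fderiv ℝ F x)

/-- The pullback of a form by a smooth map: `(f^* α)(p) = α(f ∘ p)`. -/
def DForm.pullback {X Y : Type*} [DiffeologicalSpace X] [DiffeologicalSpace Y] {k : ℕ}
    (f : X → Y) (hf : DSmooth f) (α : DForm Y k) : DForm X k where
  toFun p hp := α.toFun (f ∘ p) (hp.dSmooth_comp hf)
  smooth p hp := α.smooth (f ∘ p) (hp.dSmooth_comp hf)
  compat p hp F hF x := α.compat (f ∘ p) (hp.dSmooth_comp hf) F hF x

/-- The pullback map `π^* : Ω^k(X / H) → Ω^k(X)` by the quotient map. -/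
def orbitPullback (H X : Type*) [Group H] [MulAction H X] [DiffeologicalSpace X] (k : ℕ) :
    DForm (MulAction.orbitRel.Quotient H X) k → DForm X k :=
  DForm.pullback (orbitProj H X) (dSmooth_orbitProj H X)

/-! ### Basic forms -/

/-- `α` is invariant: `g^* α = α` for every `g`. This is used for actions by smooth maps only,
see `dSmooth_smul_manifold` and `dSmooth_smul_orbitSpace`. -/
def DForm.IsInvariant (G : Type*) [Group G] {X : Type*} [DiffeologicalSpace X] [MulAction G X]
    {k : ℕ} (α : DForm X k) : Prop :=
  ∀ (g : G) (hg : DSmooth (fun x : X => g • x)), α.pullback (fun x : X => g • x) hg = α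

/-- The plot `p` maps the vector `w` at `u` to a vector tangent to the orbit of `p u`: the curve
`t ↦ p (u + t w)` coincides near `t = 0` with the curve `t ↦ g(t) • p u` in the orbit, for some
smooth curve `g` in the Lie group `G` (modelled on `E`) with `g(0) = 1`. -/
def IsOrbitTangent (E : Type*) [NormedAddCommGroup E] [NormedSpace ℝ E]
    (G : Type*) [TopologicalSpace G] [ChartedSpace E G] [Group G]
    {X : Type*} [MulAction G X] {n : ℕ} (p : Euc n → X) (u w : Euc n) : Prop :=
  ∃ g : ℝ → G, ContMDiff 𝓘(ℝ, ℝ) 𝓘(ℝ, E) ∞ g ∧ g 0 = 1 ∧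
    ∀ᶠ t in 𝓝 (0 : ℝ), p (u + t • w) = g t • p u

/-- `α` is horizontal: it vanishes as soon as one of its arguments is tangent to an orbit. On a
manifold this says that `α_x(v, ·, …, ·) = 0` for all points `x` and all `v` in the image of the
differential at `1` of the orbit map `g ↦ g • x`, see `isHorizontal_iff_mfderiv`. -/
def DForm.IsHorizontal (E : Type*) [NormedAddCommGroup E] [NormedSpace ℝ E]
    (G : Type*) [TopologicalSpace G] [ChartedSpace E G] [Group G]
    {X : Type*} [DiffeologicalSpace X] [MulAction G X] {k : ℕ} (α : DForm X k) : Prop :=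
  ∀ (n : ℕ) (p : Euc n → X) (hp : IsPlot p) (u w : Euc n), IsOrbitTangent E G p u w →
    ∀ (v : Fin k → Euc n) (i : Fin k), v i = w → α.toFun p hp u v = 0

/-- The set `Ω^k_basic(X)` of `G`-basic `k`-forms: the horizontal and invariant ones. -/
def basicForms (E : Type*) [NormedAddCommGroup E] [NormedSpace ℝ E]
    (G : Type*) [TopologicalSpace G] [ChartedSpace E G] [Group G]
    (X : Type*) [DiffeologicalSpace X] [MulAction G X] (k : ℕ) : Set (DForm X k) :=
  {α | α.IsHorizontal E G ∧ α.IsInvariant G}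

/-! ### The actions concerned are smooth -/

theorem dSmooth_smul_manifold {E F : Type*} [NormedAddCommGroup E] [NormedSpace ℝ E]
    [NormedAddCommGroup F] [NormedSpace ℝ F]
    {G : Type*} [TopologicalSpace G] [ChartedSpace E G] [Group G]
    {N : Type*} [TopologicalSpace N] [ChartedSpace F N]
    [DiffeologicalSpace N] [IsManifoldDiffeology F N] [MulAction G N]
    [ContMDiffSMul 𝓘(ℝ, E) 𝓘(ℝ, F) ∞ G N] (g : G) : DSmooth (fun x : N => g • x) := by
  intro n p hp
  rw [IsManifoldDiffeology.isPlot_iff (E := F)] at hp ⊢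
  have h : ContMDiff (𝓘(ℝ, E).prod 𝓘(ℝ, F)) 𝓘(ℝ, F) ∞ (fun q : G × N => q.1 • q.2) :=
    contMDiff_smul
  exact h.comp (contMDiff_const.prodMk hp)

theorem dSmooth_smul_orbitSpace {G N : Type*} [Group G] [MulAction G N] [DiffeologicalSpace N]
    (K : Subgroup G) [K.Normal] (g : G) (hg : DSmooth (fun x : N => g • x)) :
    DSmooth (fun y : MulAction.orbitRel.Quotient K N => g • y) := by
  intro n p hp x
  obtain ⟨q, hq, v, hv, hxv, H⟩ := hp x
  refine ⟨fun y => g • q y, hg _ _ hq, v, hv, hxv, fun y hy => ?_⟩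
  change g • p y = _
  rw [H y hy]
  rfl

/-! ### Horizontal forms on manifolds -/

/-- The value of a form at a point depends only on the germ of the plot. -/
theorem DForm.congr_germ {X : Type*} [DiffeologicalSpace X] {k n : ℕ} (α : DForm X k)
    {p q : Euc n → X} (hp : IsPlot p) (hq : IsPlot q) {u : Euc n} (h : p =ᶠ[𝓝 u] q) :
    α.toFun p hp u = α.toFun q hq u := by
  obtain ⟨c, hc, hcu, hcx⟩ := exists_cutoff h
  have key : ∀ (r : Euc n → X) (hr : IsPlot r),
      α.toFun (r ∘ c) (isPlot_reparam hr hc) u = α.toFun r hr u := by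
    intro r hr
    rw [α.compat r hr c hc u, hcx.fderiv_eq, hcx.self_of_nhds, fderiv_id]
    rfl
  have hpq : p ∘ c = q ∘ c := funext fun y => hcu y
  rw [← key p hp, ← key q hq]
  simp only [hpq]

/-- On a manifold there is a smooth curve through a given point with a given velocity. -/
theorem exists_curve {F : Type*} [NormedAddCommGroup F] [NormedSpace ℝ F]
    [FiniteDimensional ℝ F] {G : Type*} [TopologicalSpace G] [ChartedSpace F G]
    [IsManifold 𝓘(ℝ, F) ∞ G] (x : G) (ξ : F) :
    ∃ g : ℝ → G, ContMDiff 𝓘(ℝ, ℝ) 𝓘(ℝ, F) ∞ g ∧ g 0 = x ∧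
      (mfderiv 𝓘(ℝ, ℝ) 𝓘(ℝ, F) g 0 : ℝ →L[ℝ] F) 1 = ξ := by
  let φ := extChartAt 𝓘(ℝ, F) x
  let e : F ≃L[ℝ] Euc (Module.finrank ℝ F) := toEuclidean
  have ht : e.symm ⁻¹' φ.target ∈ 𝓝 (e (φ x)) := by
    apply e.symm.continuous.continuousAt.preimage_mem_nhds
    rw [e.symm_apply_apply]
    exact extChartAt_target_mem_nhds (I := 𝓘(ℝ, F)) x
  obtain ⟨r, hr, hrt, hrx⟩ := exists_cutoff ht
  let γ : ℝ → F := fun t => φ x + t • ξ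
  have hγ : ContDiff ℝ ∞ γ := contDiff_const.add (contDiff_id.smul contDiff_const)
  have hγ0 : γ 0 = φ x := by simp [γ]
  let g : ℝ → G := fun t => φ.symm (e.symm (r (e (γ t))))
  have hg : ContMDiff 𝓘(ℝ, ℝ) 𝓘(ℝ, F) ∞ g := by
    have h1 : ContMDiffOn 𝓘(ℝ, F) 𝓘(ℝ, F) ∞ φ.symm φ.target := contMDiffOn_extChartAt_symm x
    exact h1.comp_contMDiff
      (e.symm.contDiff.comp (hr.comp (e.contDiff.comp hγ))).contMDiff (fun t => hrt _)
  have hr0 : r (e (φ x)) = e (φ x) := hrx.self_of_nhds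
  have hg0 : g 0 = x := by
    simp only [g, hγ0, hr0, e.symm_apply_apply]
    exact extChartAt_to_inv (I := 𝓘(ℝ, F)) x
  refine ⟨g, hg, hg0, ?_⟩
  have hmd : MDifferentiableAt 𝓘(ℝ, ℝ) 𝓘(ℝ, F) g 0 := (hg 0).mdifferentiableAt (by simp)
  have h3 : (mfderiv 𝓘(ℝ, ℝ) 𝓘(ℝ, F) g 0 : ℝ →L[ℝ] F) = fderiv ℝ (fun t => φ (g t)) 0 := by
    rw [hmd.mfderiv]
    simp only [modelWithCornersSelf_coe, Set.range_id, fderivWithin_univ]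
    unfold writtenInExtChartAt
    rw [hg0]
    rfl
  have h4 : (fun t => φ (g t)) =ᶠ[𝓝 0] γ := by
    have h5 : Filter.Tendsto (fun t => e (γ t)) (𝓝 0) (𝓝 (e (φ x))) := by
      rw [← hγ0]
      exact (e.continuous.comp hγ.continuous).continuousAt
    filter_upwards [h5.eventually hrx] with t ht'
    have h6 : r (e (γ t)) = e (γ t) := ht'
    have h7 : e.symm (r (e (γ t))) ∈ φ.target := hrt _
    simp only [g]
    rw [φ.right_inv h7, h6, e.symm_apply_apply]
  rw [h3, h4.fderiv_eq]
  have h8 : HasDerivAt γ ξ 0 := by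
    have h9 := ((hasDerivAt_id (0 : ℝ)).smul_const ξ).const_add (φ x)
    rwa [one_smul] at h9
  simpa using h8.hasFDerivAt.fderiv ▸ (by simp : (ContinuousLinearMap.toSpanSingleton ℝ ξ) 1 = ξ)

/-- If the curves `t ↦ Q (u + t w)` and `t ↦ f (g t)` coincide near `0`, so do their
velocities at `0`. -/
theorem mfderiv_line {E : Type*} [NormedAddCommGroup E] [NormedSpace ℝ E]
    {M : Type*} [TopologicalSpace M] [ChartedSpace E M]
    {F : Type*} [NormedAddCommGroup F] [NormedSpace ℝ F]
    {G : Type*} [TopologicalSpace G] [ChartedSpace F G] {n : ℕ} {Q : Euc n → M}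
    {f : G → M} {g : ℝ → G} {a : G} {u w : Euc n} {ξ : F}
    (hQ : ContMDiff 𝓘(ℝ, Euc n) 𝓘(ℝ, E) ∞ Q) (hf : ContMDiff 𝓘(ℝ, F) 𝓘(ℝ, E) ∞ f)
    (hg : ContMDiff 𝓘(ℝ, ℝ) 𝓘(ℝ, F) ∞ g) (ha : g 0 = a)
    (h : ∀ᶠ t in 𝓝 (0 : ℝ), Q (u + t • w) = f (g t))
    (hξ : (mfderiv 𝓘(ℝ, ℝ) 𝓘(ℝ, F) g 0 : ℝ →L[ℝ] F) 1 = ξ) :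
    (mfderiv 𝓘(ℝ, Euc n) 𝓘(ℝ, E) Q u : Euc n →L[ℝ] E) w
      = (mfderiv 𝓘(ℝ, F) 𝓘(ℝ, E) f a : F →L[ℝ] E) ξ := by
  subst ha hξ
  let ℓ : ℝ → Euc n := fun t => u + t • w
  have hℓ0 : ℓ 0 = u := by simp [ℓ]
  have hℓ : HasFDerivAt ℓ (ContinuousLinearMap.toSpanSingleton ℝ w) 0 := by
    have : HasDerivAt ℓ w 0 := by
      have h9 := ((hasDerivAt_id (0 : ℝ)).smul_const w).const_add u
      rwa [one_smul] at h9
    exact this.hasFDerivAt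
  have hQd : MDifferentiableAt 𝓘(ℝ, Euc n) 𝓘(ℝ, E) Q (ℓ 0) := (hQ _).mdifferentiableAt (by simp)
  have hfd : MDifferentiableAt 𝓘(ℝ, F) 𝓘(ℝ, E) f (g 0) := (hf _).mdifferentiableAt (by simp)
  have hgd : MDifferentiableAt 𝓘(ℝ, ℝ) 𝓘(ℝ, F) g 0 := (hg _).mdifferentiableAt (by simp)
  have h1 := (hQd.hasMFDerivAt.comp 0 hℓ.hasMFDerivAt).mfderiv
  have h2 := (hfd.hasMFDerivAt.comp 0 hgd.hasMFDerivAt).mfderiv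
  have h12 : Q ∘ ℓ =ᶠ[𝓝 0] f ∘ g := h
  have h3 := congrArg (fun A : ℝ →L[ℝ] E => A 1) (h1.symm.trans (h12.mfderiv_eq.trans h2))
  have h4 : (mfderiv 𝓘(ℝ, Euc n) 𝓘(ℝ, E) Q (ℓ 0) : Euc n →L[ℝ] E) ((1 : ℝ) • w)
      = (mfderiv 𝓘(ℝ, F) 𝓘(ℝ, E) f (g 0) : F →L[ℝ] E)
        ((mfderiv 𝓘(ℝ, ℝ) 𝓘(ℝ, F) g 0 : ℝ →L[ℝ] F) 1) := h3
  rwa [hℓ0, one_smul] at h4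

section Manifold

variable {E : Type*} [NormedAddCommGroup E] [NormedSpace ℝ E] [FiniteDimensional ℝ E]
  {M : Type*} [TopologicalSpace M] [ChartedSpace E M] [IsManifold 𝓘(ℝ, E) ∞ M]
  [DiffeologicalSpace M] [IsManifoldDiffeology E M]

/-- On a manifold, the value of a form on a plot at a point is computed by a chart from the
differential of the plot. -/
theorem DForm.eq_chart {k : ℕ} (α : DForm M k) (x : M) :
    ∃ A : E [⋀^Fin k]→L[ℝ] ℝ, ∀ (n : ℕ) (p : Euc n → M) (hp : IsPlot p) (u : Euc n),
      p u = x → ∀ v : Fin k → Euc n,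
        α.toFun p hp u v =
          A (fun i => (mfderiv 𝓘(ℝ, Euc n) 𝓘(ℝ, E) p u : Euc n →L[ℝ] E) (v i)) := by
  let φ := extChartAt 𝓘(ℝ, E) x
  let d := Module.finrank ℝ E
  let e : E ≃L[ℝ] Euc d := toEuclidean
  have ht : e.symm ⁻¹' φ.target ∈ 𝓝 (e (φ x)) := by
    apply e.symm.continuous.continuousAt.preimage_mem_nhds
    rw [e.symm_apply_apply]
    exact extChartAt_target_mem_nhds (I := 𝓘(ℝ, E)) x
  obtain ⟨r, hr, hrt, hrx⟩ := exists_cutoff ht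
  let ψ : Euc d → M := fun y => φ.symm (e.symm (r y))
  have hψ : IsPlot ψ := by
    rw [IsManifoldDiffeology.isPlot_iff (E := E)]
    have h1 : ContMDiffOn 𝓘(ℝ, E) 𝓘(ℝ, E) ∞ φ.symm φ.target := contMDiffOn_extChartAt_symm x
    exact h1.comp_contMDiff (e.symm.contDiff.comp hr).contMDiff hrt
  refine ⟨(α.toFun ψ hψ (e (φ x))).compContinuousLinearMap e, ?_⟩
  rintro n p hp u rfl v
  have hp' : ContMDiff 𝓘(ℝ, Euc n) 𝓘(ℝ, E) ∞ p := (IsManifoldDiffeology.isPlot_iff).1 hp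
  have hpc : Continuous p := hp'.continuous
  have hs : p ⁻¹' φ.source ∈ 𝓝 u :=
    hpc.continuousAt.preimage_mem_nhds (extChartAt_source_mem_nhds (I := 𝓘(ℝ, E)) (p u))
  obtain ⟨c, hc, hcs, hcu⟩ := exists_cutoff hs
  let F : Euc n → Euc d := fun y => e (φ (p (c y)))
  have hF : ContDiff ℝ ∞ F := by
    apply e.contDiff.comp
    rw [← contMDiff_iff_contDiff]
    have h1 : ContMDiffOn 𝓘(ℝ, E) 𝓘(ℝ, E) ∞ φ φ.source := by
      simpa only [φ, extChartAt_source] using contMDiffOn_extChartAt (I := 𝓘(ℝ, E)) (x := p u)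
    exact h1.comp_contMDiff (hp'.comp hc.contMDiff) hcs
  have hcu0 : c u = u := hcu.self_of_nhds
  have hFu : F u = e (φ (p u)) := by simp [F, hcu0]
  have hgerm : p =ᶠ[𝓝 u] ψ ∘ F := by
    have h2 : ∀ᶠ y in 𝓝 u, r (F y) = F y := by
      have : Filter.Tendsto F (𝓝 u) (𝓝 (e (φ (p u)))) := hFu ▸ hF.continuous.continuousAt
      exact this.eventually hrx
    filter_upwards [h2, hcu] with y hy hcy
    have hcy' : c y = y := hcy
    have hsy : p y ∈ φ.source := by simpa [hcy'] using hcs y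
    simp only [Function.comp, ψ, hy]
    simp [F, hcy', φ.left_inv hsy]
  rw [α.congr_germ hp (isPlot_reparam hψ hF) hgerm, α.compat ψ hψ F hF u, hFu]
  have hd : ∀ w : Euc n, fderiv ℝ F u w
      = e ((mfderiv 𝓘(ℝ, Euc n) 𝓘(ℝ, E) p u : Euc n →L[ℝ] E) w) := by
    intro w
    have hmd : MDifferentiableAt 𝓘(ℝ, Euc n) 𝓘(ℝ, E) p u :=
      (hp' u).mdifferentiableAt (by simp)
    have h3 : (mfderiv 𝓘(ℝ, Euc n) 𝓘(ℝ, E) p u : Euc n →L[ℝ] E)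
        = fderiv ℝ (fun y => φ (p y)) u := by
      rw [hmd.mfderiv]
      simp only [modelWithCornersSelf_coe, Set.range_id, fderivWithin_univ]
      rfl
    have h4 : F =ᶠ[𝓝 u] fun y => e (φ (p y)) := by
      filter_upwards [hcu] with y hy
      have hy' : c y = y := hy
      simp [F, hy']
    rw [h4.fderiv_eq, h3]
    change fderiv ℝ (e ∘ fun y => φ (p y)) u w = _
    rw [ContinuousLinearEquiv.comp_fderiv]
    rfl
  change α.toFun ψ hψ _ (fun i => fderiv ℝ F u (v i)) = α.toFun ψ hψ _ (fun i => e _)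
  simp only [hd]

/-- On a manifold with a smooth action of a Lie group, a form is horizontal exactly if it
vanishes as soon as one of its arguments lies in the image of the differential at `1` of the
orbit map `g ↦ g • x`. -/
theorem isHorizontal_iff_mfderiv {EG : Type*} [NormedAddCommGroup EG] [NormedSpace ℝ EG]
    [FiniteDimensional ℝ EG]
    {G : Type*} [TopologicalSpace G] [ChartedSpace EG G] [Group G] [LieGroup 𝓘(ℝ, EG) ∞ G]
    [MulAction G M] [ContMDiffSMul 𝓘(ℝ, EG) 𝓘(ℝ, E) ∞ G M] {k : ℕ} (α : DForm M k) :
    α.IsHorizontal EG G ↔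
      ∀ (n : ℕ) (p : Euc n → M) (hp : IsPlot p) (u w : Euc n) (ξ : EG),
        (mfderiv 𝓘(ℝ, Euc n) 𝓘(ℝ, E) p u : Euc n →L[ℝ] E) w
          = (mfderiv 𝓘(ℝ, EG) 𝓘(ℝ, E) (fun g : G => g • p u) 1 : EG →L[ℝ] E) ξ →
        ∀ (v : Fin k → Euc n) (i : Fin k), v i = w → α.toFun p hp u v = 0 := by
  have hact : ContMDiff (𝓘(ℝ, EG).prod 𝓘(ℝ, E)) 𝓘(ℝ, E) ∞ (fun q : G × M => q.1 • q.2) :=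
    contMDiff_smul
  have horb : ∀ x : M, ContMDiff 𝓘(ℝ, EG) 𝓘(ℝ, E) ∞ (fun g : G => g • x) := fun x =>
    hact.comp (contMDiff_id.prodMk contMDiff_const)
  constructor
  · intro H n p hp u w ξ hξ v i hv
    have hp' : ContMDiff 𝓘(ℝ, Euc n) 𝓘(ℝ, E) ∞ p := (IsManifoldDiffeology.isPlot_iff).1 hp
    obtain ⟨g, hg, hg0, hgξ⟩ := exists_curve (G := G) 1 ξ
    let T : Euc (n + 1) →L[ℝ] Euc n := LinearMap.toContinuousLinearMap
      { toFun := fun y => WithLp.toLp 2 fun j : Fin n => y j.succ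
        map_add' := fun _ _ => rfl
        map_smul' := fun _ _ => rfl }
    let S : Euc n →L[ℝ] Euc (n + 1) := LinearMap.toContinuousLinearMap
      { toFun := fun y => WithLp.toLp 2 (Fin.cons 0 fun j : Fin n => y j : Fin (n + 1) → ℝ)
        map_add' := fun a b => by
          ext j
          refine Fin.cases ?_ (fun j => ?_) j <;> simp
        map_smul' := fun a b => by
          ext j
          refine Fin.cases ?_ (fun j => ?_) j <;> simp }
    let C : Euc (n + 1) →L[ℝ] ℝ := EuclideanSpace.proj 0
    let w₀ : Euc (n + 1) := EuclideanSpace.single 0 1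
    have hTS : ∀ y, T (S y) = y := fun y => by
      ext j
      exact Fin.cons_succ (α := fun _ => ℝ) 0 (fun j => y j) j
    have hCS : ∀ y, C (S y) = 0 := fun y => by simp [C, S]
    have hTw : T w₀ = 0 := by
      ext j
      change w₀ j.succ = 0
      simp [w₀]
    have hCw : C w₀ = 1 := by simp [C, w₀]
    let Q : Euc (n + 1) → M := fun y => g (C y) • p (T y)
    have hQ' : ContMDiff 𝓘(ℝ, Euc (n + 1)) 𝓘(ℝ, E) ∞ Q :=
      hact.comp ((hg.comp C.contDiff.contMDiff).prodMk (hp'.comp T.contDiff.contMDiff))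
    have hQ : IsPlot Q := (IsManifoldDiffeology.isPlot_iff (E := E)).2 hQ'
    have hQU : Q (S u) = p u := by simp [Q, hTS, hCS, hg0]
    have hQℓ : ∀ t : ℝ, Q (S u + t • w₀) = g t • p u := fun t => by
      simp [Q, hTS, hCS, hTw, hCw]
    have hQd : MDifferentiableAt 𝓘(ℝ, Euc (n + 1)) 𝓘(ℝ, E) Q (S u) :=
      (hQ' _).mdifferentiableAt (by simp)
    have hd1 : ∀ y, (mfderiv 𝓘(ℝ, Euc (n + 1)) 𝓘(ℝ, E) Q (S u) : Euc (n + 1) →L[ℝ] E) (S y)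
        = (mfderiv 𝓘(ℝ, Euc n) 𝓘(ℝ, E) p u : Euc n →L[ℝ] E) y := by
      intro y
      have hps : p = Q ∘ S := by funext z; simp [Q, hTS, hCS, hg0]
      have h1 := (hQd.hasMFDerivAt.comp u S.hasFDerivAt.hasMFDerivAt).mfderiv
      rw [← hps] at h1
      rw [h1]
      rfl
    have hd2 : (mfderiv 𝓘(ℝ, Euc (n + 1)) 𝓘(ℝ, E) Q (S u) : Euc (n + 1) →L[ℝ] E) w₀
        = (mfderiv 𝓘(ℝ, Euc n) 𝓘(ℝ, E) p u : Euc n →L[ℝ] E) w :=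
      (mfderiv_line hQ' (horb (p u)) hg hg0 (.of_forall hQℓ) hgξ).trans hξ.symm
    obtain ⟨A, hA⟩ := α.eq_chart (E := E) (p u)
    have hz := H (n + 1) Q hQ (S u) w₀
      ⟨g, hg, hg0, .of_forall fun t => by rw [hQℓ, hQU]⟩
      (Function.update (fun j => S (v j)) i w₀) i (by simp)
    rw [hA _ Q hQ (S u) hQU] at hz
    rw [hA _ p hp u rfl, ← hz]
    congr 1
    funext j
    by_cases hj : j = i
    · subst hj
      rw [Function.update_self, hd2, hv]
    · rw [Function.update_of_ne hj, hd1]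
  · rintro H n p hp u w ⟨g, hg, hg0, hev⟩ v i hv
    have hp' : ContMDiff 𝓘(ℝ, Euc n) 𝓘(ℝ, E) ∞ p := (IsManifoldDiffeology.isPlot_iff).1 hp
    let ξ : EG := (mfderiv 𝓘(ℝ, ℝ) 𝓘(ℝ, EG) g 0 : ℝ →L[ℝ] EG) 1
    refine H n p hp u w ξ ?_ v i hv
    exact mfderiv_line hp' (horb (p u)) hg hg0 hev rfl

end Manifold

/-! ### Properness and orbit type -/

/-- The Lie group `L`, acting on `N` through the homomorphism `ι : L → G`, acts properly:
`(l, x) ↦ (x, l • x)` is a proper map. -/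
def ActsProperly {L G N : Type*} [Group L] [TopologicalSpace L] [Group G]
    [TopologicalSpace N] [MulAction G N] (ι : L →* G) : Prop :=
  IsProperMap (fun q : L × N => (q.2, ι q.1 • q.2))

/-- The group `L`, acting on `N` through the homomorphism `ι : L → G`, acts with constant
orbit-type: all stabilisers in `L` are conjugate in `L`. -/
def HasConstantOrbitType {L G : Type*} (N : Type*) [Group L] [Group G] [MulAction G N]
    (ι : L →* G) : Prop :=
  ∀ x y : N, ∃ l : L, ∀ h : L, ι h • x = x ↔ ι (l * h * l⁻¹) • y = y

end QuotientInStages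

end

namespace QuotientInStages

/-! ### Forms on quotients -/

section Quotient

variable {X : Type*} [DiffeologicalSpace X] {k n : ℕ}

/-! Since `K` lies in `G`, two points of `N` have the same image in `(N/K)/G` exactly when they lie
in one `G`-orbit, so `e` exists and is bijective. It is smooth both ways because a map out of a
quotient is smooth once its composite with the projection is. Part (iii) follows from `π_K^* ∘
π_{G/K}^* = π_G^* ∘ e^*` and the injectivity of pullback along a quotient map.

For basic forms the core is `toFun_eq_of_mem_basicForms`: a `G`-basic form on `N` takes equal values
on plots `p`, `q` with `q y ∈ G • p y` for all `y`, although the group elements may depend on `y`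
without any continuity. As the values are continuous, it suffices to compare them on a dense set of
points `u`. Two kinds of genericity are combined. By Baire (`dense_setOf_eventually_exists_mem`), an
element `g` with `g • p u = q u` is a limit of elements relating `p y` to `q y` for `y` near `u`.
The stabiliser dimension is upper semicontinuous and integer-valued, hence locally constant near a
generic `u`; there `(h, y) ↦ (y, h • p y)` has constant rank, and
`exists_fderiv_eq_of_finrank_ker_le` differentiates the relation despite the discontinuous lifts. So
the velocities of `q` and `g • p` at `u` agree modulo the orbit direction
(`dense_setOf_mfderiv_eq_add`), and invariance and horizontality finish the comparison.

Hence a basic form descends to `N/K`. Its descent is horizontal by the same density argument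
(`toFun_eq_zero_of_line_mem_orbit`): a curve in a `G`-orbit of `N/K` lifts to a curve in a `G`-orbit
of `N`, again with no control over the group elements. -/

theorem dSmooth_quotientMk (s : Setoid X) : DSmooth (Quotient.mk s) := fun _ p hp _ =>
  ⟨p, hp, Set.univ, isOpen_univ, trivial, fun _ _ => rfl⟩

theorem IsPlot.exists_lift {s : Setoid X} {p : Euc n → Quotient s} (hp : IsPlot p) (u : Euc n) :
    ∃ q : Euc n → X, IsPlot q ∧ p =ᶠ[𝓝 u] Quotient.mk s ∘ q := by
  obtain ⟨q, hq, v, hv, hu, H⟩ := hp u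
  exact ⟨q, hq, Filter.eventually_of_mem (hv.mem_nhds hu) H⟩

/-- A map out of a quotient is smooth as soon as its composition with the quotient map is. -/
theorem dSmooth_of_comp_quotientMk {Y : Type*} [DiffeologicalSpace Y] {s : Setoid X}
    {f : Quotient s → Y} (hf : DSmooth (f ∘ Quotient.mk s)) : DSmooth f := by
  intro n p hp
  refine DiffeologicalSpace.locality fun u => ?_
  obtain ⟨q, hq, v, hv, hu, H⟩ := hp u
  refine ⟨v, hv, hu, fun {m} {r} hr hrs => ?_⟩
  have h : (f ∘ p) ∘ r = (f ∘ Quotient.mk s) ∘ (q ∘ r) :=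
    funext fun y => congrArg f (H _ (hr y))
  rw [h]
  exact hf _ _ (isPlot_reparam hq hrs)

/-- Pulling back forms by a quotient map is injective. -/
theorem pullback_quotientMk_injective (s : Setoid X) :
    Function.Injective (DForm.pullback (k := k) (Quotient.mk s) (dSmooth_quotientMk s)) := by
  intro α β h
  ext n p hp : 4
  funext u
  -- A form sees only germs of plots, and each germ of a plot of the quotient lifts.
  obtain ⟨q, hq, hpq⟩ := IsPlot.exists_lift hp u
  rw [α.congr_germ hp (hq.dSmooth_comp (dSmooth_quotientMk s)) hpq,
    β.congr_germ hp (hq.dSmooth_comp (dSmooth_quotientMk s)) hpq]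
  exact congrArg (fun γ : DForm X k => γ.toFun q hq u) h

/-- A form that takes the same values on any two plots with the same projection to a quotient
is the pullback of a form on the quotient. -/
theorem exists_pullback_quotientMk_eq (s : Setoid X) (α : DForm X k)
    (hα : ∀ (n : ℕ) (p q : Euc n → X) (hp : IsPlot p) (hq : IsPlot q),
      Quotient.mk s ∘ p = Quotient.mk s ∘ q → α.toFun p hp = α.toFun q hq) :
    ∃ β : DForm (Quotient s) k, DForm.pullback (Quotient.mk s) (dSmooth_quotientMk s) β = α := by
  have hgerm : ∀ {n : ℕ} {p q : Euc n → X} (hp : IsPlot p) (hq : IsPlot q) {u : Euc n},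
      Quotient.mk s ∘ p =ᶠ[𝓝 u] Quotient.mk s ∘ q → α.toFun p hp u = α.toFun q hq u := by
    intro n p q hp hq u h
    -- Precomposing with the cutoff makes the two projections agree everywhere, as `hα` requires,
    -- without changing the germs at `u`.
    obtain ⟨c, hc, hcu, hcx⟩ := exists_cutoff h
    have h1 : ∀ r : Euc n → X, r =ᶠ[𝓝 u] r ∘ c := fun r => by
      filter_upwards [hcx] with y hy
      exact congrArg r hy.symm
    rw [α.congr_germ hp (isPlot_reparam hp hc) (h1 p),
      α.congr_germ hq (isPlot_reparam hq hc) (h1 q),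
      hα n _ _ (isPlot_reparam hp hc) (isPlot_reparam hq hc) (funext fun y => hcu y)]
  -- A lift is chosen separately for each point; `key` shows that the value does not depend on it,
  -- so no coherence is needed.
  choose L hL hLp using
    fun {n : ℕ} (p : Euc n → Quotient s) (hp : IsPlot p) (u : Euc n) => IsPlot.exists_lift hp u
  have key : ∀ {n : ℕ} {p : Euc n → Quotient s} (hp : IsPlot p) {q : Euc n → X} (hq : IsPlot q)
      {u : Euc n}, p =ᶠ[𝓝 u] Quotient.mk s ∘ q →
      α.toFun (L p hp u) (hL p hp u) u = α.toFun q hq u := fun hp q hq u h =>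
    hgerm _ _ ((hLp _ hp u).symm.trans h)
  refine ⟨⟨fun p hp u => α.toFun (L p hp u) (hL p hp u) u, fun {n} p hp => ?_,
    fun {n m} p hp F hF x => ?_⟩, ?_⟩
  · rw [contDiff_iff_contDiffAt]
    intro u
    -- The lift chosen at `u` also computes the values at all nearby points.
    refine (α.smooth _ (hL p hp u)).contDiffAt.congr_of_eventuallyEq ?_
    filter_upwards [(hLp p hp u).eventuallyEq_nhds] with y hy
    exact key hp _ hy
  · rw [← α.compat _ (hL p hp (F x)) F hF x]
    exact key _ _ ((hLp p hp (F x)).comp_tendsto hF.continuous.continuousAt)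
  · ext n p hp : 4
    funext u
    exact key _ hp (.refl _ _)

end Quotient

section Pullback

variable {X Y : Type*} [DiffeologicalSpace X] [DiffeologicalSpace Y] {k : ℕ}

theorem DForm.pullback_congr {f g : X → Y} (hf : DSmooth f) (hg : DSmooth g) (h : f = g)
    (α : DForm Y k) : α.pullback f hf = α.pullback g hg := by
  subst h; rfl

end Pullback

/-! ### The comparison map of orbit spaces -/

section OrbitSpaces

variable {G N : Type*} [Group G] [MulAction G N] (K : Subgroup G) [K.Normal]

theorem orbitProj_eq_iff {H X : Type*} [Group H] [MulAction H X] {x y : X} :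
    orbitProj H X x = orbitProj H X y ↔ ∃ h : H, h • y = x :=
  Quotient.eq (r := MulAction.orbitRel H X)

/-- An element of `K` is itself in `G`, so it is absorbed into the element of `G` relating the two
points. -/
theorem orbitProj_orbitProj_eq_iff {x y : N} :
    orbitProj G (MulAction.orbitRel.Quotient K N) (orbitProj K N x)
      = orbitProj G (MulAction.orbitRel.Quotient K N) (orbitProj K N y)
      ↔ orbitProj G N x = orbitProj G N y := by
  rw [orbitProj_eq_iff, orbitProj_eq_iff]
  constructor
  · rintro ⟨g, hg⟩
    rw [smul_orbitProj, eq_comm, orbitProj_eq_iff] at hg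
    obtain ⟨h, rfl⟩ := hg
    exact ⟨h * g, mul_smul _ _ _⟩
  · rintro ⟨g, rfl⟩
    exact ⟨g, rfl⟩

theorem orbitProj_surjective (H X : Type*) [Group H] [MulAction H X] :
    Function.Surjective (orbitProj H X) := Quotient.exists_rep

theorem existsUnique_stageMap :
    ∃! e : MulAction.orbitRel.Quotient G N →
        MulAction.orbitRel.Quotient G (MulAction.orbitRel.Quotient K N),
      e ∘ orbitProj G N = orbitProj G (MulAction.orbitRel.Quotient K N) ∘ orbitProj K N := by
  refine ⟨Quotient.lift (orbitProj G _ ∘ orbitProj K N) fun x y h =>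
    (orbitProj_orbitProj_eq_iff K).2 (Quotient.sound h), rfl, fun e he => ?_⟩
  funext y
  obtain ⟨x, rfl⟩ := orbitProj_surjective G N y
  exact congrFun he x

theorem isDDiffeomorphism_stageMap [DiffeologicalSpace N]
    {e : MulAction.orbitRel.Quotient G N →
      MulAction.orbitRel.Quotient G (MulAction.orbitRel.Quotient K N)}
    (he : e ∘ orbitProj G N = orbitProj G (MulAction.orbitRel.Quotient K N) ∘ orbitProj K N) :
    IsDDiffeomorphism e := by
  have he' : ∀ x, e (orbitProj G N x) = orbitProj G _ (orbitProj K N x) := congrFun he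
  have hbij : Function.Bijective e := by
    constructor
    · intro a b hab
      obtain ⟨x, rfl⟩ := orbitProj_surjective G N a
      obtain ⟨y, rfl⟩ := orbitProj_surjective G N b
      rw [he', he'] at hab
      exact (orbitProj_orbitProj_eq_iff K).1 hab
    · intro c
      obtain ⟨b, rfl⟩ := orbitProj_surjective G _ c
      obtain ⟨x, rfl⟩ := orbitProj_surjective K N b
      exact ⟨_, he' x⟩
  let E := Equiv.ofBijective e hbij
  have hs : ∀ x, E.symm (orbitProj G _ (orbitProj K N x)) = orbitProj G N x := fun x =>
    E.symm_apply_eq.2 (he' x).symm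
  refine ⟨dSmooth_of_comp_quotientMk (s := MulAction.orbitRel G N) ?_, E.symm, ?_,
    E.left_inv, E.right_inv⟩
  · change DSmooth (e ∘ orbitProj G N)
    rw [he]
    exact (dSmooth_orbitProj _ _).comp (dSmooth_orbitProj _ _)
  · refine dSmooth_of_comp_quotientMk (s := MulAction.orbitRel G _)
      (dSmooth_of_comp_quotientMk (s := MulAction.orbitRel K N) ?_)
    change DSmooth fun x => E.symm (orbitProj G _ (orbitProj K N x))
    rw [funext hs]
    exact dSmooth_orbitProj G N

theorem orbitPullback_injective (H X : Type*) [Group H] [MulAction H X] [DiffeologicalSpace X]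
    (k : ℕ) : Function.Injective (orbitPullback H X k) :=
  pullback_quotientMk_injective (MulAction.orbitRel H X)

/-- Transport along the diffeomorphism `e` identifies the forms on the two iterated quotients,
compatibly with the pullbacks to `N`. -/
theorem bijOn_range_orbitPullback [DiffeologicalSpace N] (k : ℕ) :
    Set.BijOn (orbitPullback K N k)
      (Set.range (orbitPullback G (MulAction.orbitRel.Quotient K N) k))
      (Set.range (orbitPullback G N k)) := by
  obtain ⟨e, he, -⟩ := existsUnique_stageMap (N := N) K
  obtain ⟨hes, e', hes', -, hr⟩ := isDDiffeomorphism_stageMap K he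
  have hcomm : ∀ γ, orbitPullback K N k (orbitPullback G _ k γ)
      = orbitPullback G N k (γ.pullback e hes) := fun γ =>
    DForm.pullback_congr ((dSmooth_orbitProj _ _).comp (dSmooth_orbitProj _ _))
      (hes.comp (dSmooth_orbitProj _ _)) he.symm γ
  refine ⟨?_, (orbitPullback_injective K N k).injOn, ?_⟩
  · rintro _ ⟨γ, rfl⟩
    exact ⟨_, (hcomm γ).symm⟩
  · rintro _ ⟨γ, rfl⟩
    refine ⟨_, ⟨γ.pullback e' hes', rfl⟩, ?_⟩
    rw [hcomm]
    refine congrArg _ ?_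
    have hl : e' ∘ e = id := by
      funext y
      obtain ⟨x, rfl⟩ := orbitProj_surjective G N y
      have h1 : e (e' (e (orbitProj G N x))) = e (orbitProj G N x) := hr _
      obtain ⟨z, hz⟩ := orbitProj_surjective G N (e' (e (orbitProj G N x)))
      have he' : ∀ x, e (orbitProj G N x) = orbitProj G _ (orbitProj K N x) := congrFun he
      change e' (e (orbitProj G N x)) = orbitProj G N x
      rw [← hz, he', he'] at h1
      rw [← hz]
      exact (orbitProj_orbitProj_eq_iff K).1 h1
    exact DForm.pullback_congr (hes'.comp hes) dSmooth_id hl γ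

end OrbitSpaces

/-! ### Maps of constant rank -/

/-- Let `f` be a map whose differential at `a` has minimal kernel dimension among nearby points.
Then a differentiable map which lifts pointwise through `f`, by lifts that tend to `a` but are
not required to be continuous, has its differential in the image of the differential of `f`. -/
theorem exists_fderiv_eq_of_finrank_ker_le {E F X : Type*}
    [NormedAddCommGroup E] [NormedSpace ℝ E] [FiniteDimensional ℝ E]
    [NormedAddCommGroup F] [NormedSpace ℝ F] [FiniteDimensional ℝ F]
    [NormedAddCommGroup X] [NormedSpace ℝ X]
    {f : E → F} {a : E} (hf : ContDiffAt ℝ 1 f a)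
    (hker : ∀ᶠ z in 𝓝 a, Module.finrank ℝ (fderiv ℝ f a).ker ≤
      Module.finrank ℝ (fderiv ℝ f z).ker)
    {c : X → F} {c' : X →L[ℝ] F} {u : X} (hc : HasFDerivAt c c' u) (hcu : c u = f a)
    (hlift : ∀ s ∈ 𝓝 a, ∀ᶠ y in 𝓝 u, ∃ z ∈ s, c y = f z) (v : X) :
    ∃ ξ : E, c' v = fderiv ℝ f a ξ := by
  set A := fderiv ℝ f a with hA
  have hfd : HasFDerivAt f A a := (hf.differentiableAt (by simp)).hasFDerivAt
  -- `P` and `Q` are linear projections onto the image and the kernel of `A`. The map `h = (P ∘ f,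
  -- Q)` has invertible differential at `a`, so it gives local coordinates, with inverse `g`.
  obtain ⟨P₀, hP₀⟩ := LinearMap.exists_leftInverse_of_injective A.range.subtype
    (Submodule.ker_subtype _)
  obtain ⟨Q₀, hQ₀⟩ := LinearMap.exists_leftInverse_of_injective A.ker.subtype
    (Submodule.ker_subtype _)
  let P : F →L[ℝ] A.range := P₀.toContinuousLinearMap
  let Q : E →L[ℝ] A.ker := Q₀.toContinuousLinearMap
  have hP : ∀ r : A.range, P r = r := LinearMap.congr_fun hP₀
  have hQ : ∀ k : A.ker, Q k = k := LinearMap.congr_fun hQ₀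
  let h : E → A.range × A.ker := fun z => (P (f z), Q z)
  let D : E →L[ℝ] A.range × A.ker := (P.comp A).prod Q
  have hDinj : Function.Injective D := by
    rw [injective_iff_map_eq_zero]
    intro z hz
    have h1 : P (A z) = 0 := congrArg Prod.fst hz
    have h2 : Q z = 0 := congrArg Prod.snd hz
    have h3 : A z = 0 := by
      have := hP ⟨A z, z, rfl⟩
      rw [h1] at this
      exact (congrArg Subtype.val this).symm
    have h4 := hQ ⟨z, h3⟩
    rw [h2] at h4
    exact (congrArg Subtype.val h4).symm
  have hdim : Module.finrank ℝ A.range + Module.finrank ℝ A.ker = Module.finrank ℝ E :=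
    LinearMap.finrank_range_add_finrank_ker (A : E →ₗ[ℝ] F)
  let e : E ≃L[ℝ] A.range × A.ker := (LinearMap.linearEquivOfInjective (D : E →ₗ[ℝ] _) hDinj
    (by rw [Module.finrank_prod, hdim])).toContinuousLinearEquiv
  have hh : ContDiffAt ℝ 1 h a :=
    (P.contDiff.contDiffAt.comp a hf).prodMk Q.contDiff.contDiffAt
  have hhd : HasFDerivAt h (e : E →L[ℝ] A.range × A.ker) a := by
    have h1 : HasFDerivAt h D a := (P.hasFDerivAt.comp a hfd).prodMk Q.hasFDerivAt
    exact h1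
  let H := hh.toOpenPartialHomeomorph h hhd one_ne_zero
  have haH : a ∈ H.source := hh.mem_toOpenPartialHomeomorph_source hhd one_ne_zero
  let g : A.range × A.ker → E := H.symm
  have hg : ContDiffAt ℝ 1 g (h a) := hh.to_localInverse hhd one_ne_zero
  have hga : g (h a) = a := H.left_inv haH
  have hgh : ∀ᶠ z in 𝓝 a, g (h z) = z := H.eventually_left_inverse haH
  have hhg : ∀ᶠ w in 𝓝 (h a), h (g w) = w := H.eventually_right_inverse (H.map_source haH)
  have hgc : Filter.Tendsto g (𝓝 (h a)) (𝓝 a) := by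
    simpa only [ContinuousAt, hga] using hg.continuousAt
  have hgood : ∀ᶠ w in 𝓝 (h a), HasFDerivAt (f ∘ g) ((fderiv ℝ f (g w)).comp (fderiv ℝ g w)) w ∧
      ∀ k : A.ker, fderiv ℝ f (g w) (fderiv ℝ g w (0, k)) = 0 := by
    filter_upwards [hg.eventually (by simp), hgc.eventually (hf.eventually (by simp)),
      hgc.eventually hker, hhg.eventually_nhds] with w hgw hfw hkw hhw
    have hgd : HasFDerivAt g (fderiv ℝ g w) w := (hgw.differentiableAt (by simp)).hasFDerivAt
    have hfd : HasFDerivAt f (fderiv ℝ f (g w)) (g w) :=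
      (hfw.differentiableAt (by simp)).hasFDerivAt
    refine ⟨hfd.comp w hgd, ?_⟩
    have h1 : HasFDerivAt (fun w => P (f (g w)))
        (P.comp ((fderiv ℝ f (g w)).comp (fderiv ℝ g w))) w :=
      P.hasFDerivAt.comp w (hfd.comp w hgd)
    have h2 : HasFDerivAt (fun w => P (f (g w))) (ContinuousLinearMap.fst ℝ A.range A.ker) w := by
      refine hasFDerivAt_fst.congr_of_eventuallyEq ?_
      filter_upwards [hhw] with w' hw'
      exact congrArg Prod.fst hw'
    have h3 : ∀ x, P (fderiv ℝ f (g w) (fderiv ℝ g w x)) = x.1 := fun x =>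
      DFunLike.congr_fun (h1.unique h2) x
    -- In the coordinates, `P ∘ f` is the first projection, so `P ∘ df` is onto and its kernel has
    -- the dimension of `ker A`. It contains `ker df`, which is at least as large by `hker`; so they
    -- coincide, and `df` kills the `ker A` directions.
    let B : E →ₗ[ℝ] A.range := (P.comp (fderiv ℝ f (g w)) : E →L[ℝ] A.range)
    have hB : LinearMap.range B = ⊤ := LinearMap.range_eq_top.2 fun r => ⟨_, h3 (r, 0)⟩
    have hBdim := LinearMap.finrank_range_add_finrank_ker B
    rw [hB, finrank_top] at hBdim
    have hle : (fderiv ℝ f (g w)).ker ≤ LinearMap.ker B := fun z hz => by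
      have hz' : fderiv ℝ f (g w) z = 0 := hz
      change P (fderiv ℝ f (g w) z) = 0
      rw [hz', map_zero]
    have heq := Submodule.eq_of_le_of_finrank_le hle (by omega)
    intro k
    have : fderiv ℝ g w (0, k) ∈ LinearMap.ker B := h3 (0, k)
    rw [← heq] at this
    exact this
  obtain ⟨ε, hε, hball⟩ := Metric.eventually_nhds_iff_ball.1 hgood
  -- The partial differential in the kernel variable vanishes on a ball, so `f ∘ g` depends only on
  -- the first coordinate there.
  have hconst : ∀ w ∈ Metric.ball (h a) ε, f (g w) = f (g (w.1, (h a).2)) := by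
    rintro ⟨r, k⟩ hw
    rw [← ball_prod_same] at hw
    have hd : ∀ k' ∈ Metric.ball (h a).2 ε, HasFDerivAt (fun k' => f (g (r, k')))
        (0 : A.ker →L[ℝ] F) k' := by
      intro k' hk'
      obtain ⟨h1, h2⟩ := hball (r, k') (by rw [← ball_prod_same]; exact ⟨hw.1, hk'⟩)
      have h3 := h1.comp k' (hasFDerivAt_prodMk_right r k')
      exact h3.congr_fderiv (ContinuousLinearMap.ext fun κ => h2 κ)
    refine (convex_ball (h a).2 ε).is_const_of_fderivWithin_eq_zero (𝕜 := ℝ)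
      (f := fun k' => f (g (r, k')))
      (fun k' hk' => (hd k' hk').differentiableAt.differentiableWithinAt) (fun k' hk' => ?_)
      hw.2 (Metric.mem_ball_self hε)
    rw [fderivWithin_of_isOpen Metric.isOpen_ball hk', (hd k' hk').fderiv]
  have hσ : HasFDerivAt (fun r => f (g (r, (h a).2)))
      ((A.comp (fderiv ℝ g (h a))).comp (ContinuousLinearMap.inl ℝ A.range A.ker)) (h a).1 := by
    have h1 := (hball (h a) (Metric.mem_ball_self hε)).1
    rw [hga] at h1
    have h2 : HasFDerivAt (fun r : A.range => (r, (h a).2))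
        (ContinuousLinearMap.inl ℝ A.range A.ker) (h a).1 := hasFDerivAt_prodMk_left _ _
    exact HasFDerivAt.comp (h a).1 (g := f ∘ g) h1 h2
  -- The lift `z` drops out: `c y` is recovered from `P (c y)` alone. Differentiating this identity
  -- puts `c'` in the image of `A`.
  have hcσ : (fun y => f (g (P (c y), (h a).2))) =ᶠ[𝓝 u] c := by
    have hs : {z | g (h z) = z} ∩ h ⁻¹' Metric.ball (h a) ε ∈ 𝓝 a :=
      Filter.inter_mem hgh (hh.continuousAt.preimage_mem_nhds (Metric.ball_mem_nhds _ hε))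
    filter_upwards [hlift _ hs] with y ⟨z, ⟨hz1, hz2⟩, hz3⟩
    have h1 := hconst _ hz2
    rw [hz1] at h1
    change f (g (P (c y), (h a).2)) = c y
    rw [hz3]
    exact h1.symm
  have hPc : HasFDerivAt (fun y => P (c y)) (P.comp c') u := P.hasFDerivAt.comp u hc
  have hu : P (c u) = (h a).1 := by rw [hcu]
  rw [← hu] at hσ
  have hσc : HasFDerivAt (fun y => f (g (P (c y), (h a).2))) _ u :=
    HasFDerivAt.comp u (g := fun r => f (g (r, (h a).2))) hσ hPc
  have hfin := hσc.unique (hc.congr_of_eventuallyEq hcσ)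
  exact ⟨_, (DFunLike.congr_fun hfin v).symm⟩

/-! ### A consequence of the Baire category theorem -/

/-- At a generic point, every point of the fibre of a closed relation is a limit of points of the
neighbouring fibres. -/
theorem dense_setOf_eventually_exists_mem {Γ Y : Type*} [TopologicalSpace Γ] [T2Space Γ]
    [SecondCountableTopology Γ] [LocallyCompactSpace Γ] [TopologicalSpace Y] [BaireSpace Y]
    {Z : Set (Γ × Y)} (hZ : IsClosed Z) :
    Dense {u : Y | ∀ g, (g, u) ∈ Z → ∀ s ∈ 𝓝 g, ∀ᶠ y in 𝓝 u, ∃ z ∈ s, (z, y) ∈ Z} := by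
  let S : Set (Set Γ) := {B ∈ TopologicalSpace.countableBasis Γ | IsCompact (closure B)}
  let C : Set Γ → Set Y := fun B => Prod.snd '' ((closure B ×ˢ Set.univ) ∩ Z)
  have hC : ∀ B ∈ S, IsClosed (C B) := by
    intro B hB
    have : CompactSpace (closure B) := isCompact_iff_compactSpace.1 hB.2
    have h1 : C B = Prod.snd '' ((fun q : closure B × Y => ((q.1 : Γ), q.2)) ⁻¹' Z) := by
      ext y
      constructor
      · rintro ⟨⟨z, _⟩, ⟨⟨hz, -⟩, hzZ⟩, rfl⟩
        exact ⟨(⟨z, hz⟩, _), hzZ, rfl⟩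
      · rintro ⟨⟨z, _⟩, hzZ, rfl⟩
        exact ⟨(z, _), ⟨⟨z.2, trivial⟩, hzZ⟩, rfl⟩
    rw [h1]
    exact isClosedMap_snd_of_compactSpace _
      (hZ.preimage (continuous_subtype_val.prodMap continuous_id))
  -- Each `C B` is closed, so its frontier is nowhere dense, and there are countably many.
  have hd : Dense (⋂ B ∈ S, (frontier (C B))ᶜ) := by
    refine dense_biInter_of_isOpen (fun B _ => isClosed_frontier.isOpen_compl)
      ((TopologicalSpace.countable_countableBasis Γ).mono fun B hB => hB.1) fun B hB => ?_
    rw [← interior_eq_empty_iff_dense_compl]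
    exact interior_frontier (hC B hB)
  refine hd.mono fun u hu g hg s hs => ?_
  obtain ⟨K, hK, hKs, hKc⟩ := local_compact_nhds hs
  obtain ⟨B, hB, hgB, hBK⟩ := (TopologicalSpace.isBasis_countableBasis Γ).exists_subset_of_mem_open
    (mem_interior_iff_mem_nhds.2 hK) isOpen_interior
  have hcl : closure B ⊆ K := closure_minimal (hBK.trans interior_subset) hKc.isClosed
  have hBS : B ∈ S := ⟨hB, hKc.of_isClosed_subset isClosed_closure hcl⟩
  -- Off the frontiers, lying in `C B` means lying in its interior: all nearby fibres meet the small
  -- set `closure B` around `g`.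
  have huC : u ∈ C B := ⟨(g, u), ⟨⟨subset_closure hgB, trivial⟩, hg⟩, rfl⟩
  have hint : u ∈ interior (C B) := by
    by_contra h
    exact Set.mem_iInter₂.1 hu B hBS ⟨subset_closure huC, h⟩
  filter_upwards [mem_interior_iff_mem_nhds.1 hint]
  rintro _ ⟨⟨z, _⟩, ⟨⟨hz, -⟩, hzZ⟩, rfl⟩
  exact ⟨z, hKs (hcl hz), hzZ⟩

/-! ### Kernels of linear maps -/

section Kernels

variable {E F : Type*} [NormedAddCommGroup E] [NormedSpace ℝ E]
  [NormedAddCommGroup F] [NormedSpace ℝ F]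

/-- The dimension of the kernel is upper semicontinuous. -/
theorem eventually_finrank_ker_le [FiniteDimensional ℝ E] {X : Type*} [TopologicalSpace X]
    {A : X → E →L[ℝ] F} {u : X}
    (hA : ContinuousAt A u) :
    ∀ᶠ y in 𝓝 u, Module.finrank ℝ (A y).ker ≤ Module.finrank ℝ (A u).ker := by
  -- Having rank at least a given number is an open condition; rank-nullity turns it into a bound on
  -- the kernel.
  have h := (isOpen_setOfPred_nat_le_rank (𝕜 := ℝ) (E := E) (F := F)
    (Module.finrank ℝ (A u).range)).mem_nhds (x := A u) (Module.finrank_eq_rank ℝ _).le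
  filter_upwards [hA h] with y hy
  have h1 : Module.finrank ℝ (A u).range ≤ Module.finrank ℝ (A y).range := by
    have hy' : (Module.finrank ℝ (A u).range : Cardinal) ≤ (A y : E →ₗ[ℝ] F).rank := hy
    rw [LinearMap.rank, ← Module.finrank_eq_rank] at hy'
    exact_mod_cast hy'
  have h2 := LinearMap.finrank_range_add_finrank_ker (A y : E →ₗ[ℝ] F)
  have h3 := LinearMap.finrank_range_add_finrank_ker (A u : E →ₗ[ℝ] F)
  omega

theorem finrank_ker_eq_of_intertwining {E' F' : Type*} [NormedAddCommGroup E'] [NormedSpace ℝ E']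
    [NormedAddCommGroup F'] [NormedSpace ℝ F'] {A : E →L[ℝ] F} {B : E' →L[ℝ] F'}
    (e : E ≃L[ℝ] E') (i : F ≃L[ℝ] F') (h : ∀ x, B (e x) = i (A x)) :
    Module.finrank ℝ A.ker = Module.finrank ℝ B.ker := by
  have hB : B.ker = A.ker.map e.toLinearEquiv.toLinearMap := by
    ext y
    constructor
    · intro hy
      have hy' : B y = 0 := hy
      refine ⟨e.symm y, i.injective ?_, e.apply_symm_apply y⟩
      have h1 := h (e.symm y)
      rw [e.apply_symm_apply, hy'] at h1
      exact h1.symm.trans (map_zero i).symm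
    · rintro ⟨x, hx, rfl⟩
      have hx' : A x = 0 := hx
      change B (e x) = 0
      rw [h, hx', map_zero]
  rw [hB]
  exact (e.toLinearEquiv.finrank_map_eq A.ker).symm

/-- A kernel vector has zero component in `V`. This reduces the rank of `(ξ, y) ↦ (y, ξ • p y)` to
that of orbit maps. -/
theorem finrank_ker_snd_prod {V : Type*} [NormedAddCommGroup V] [NormedSpace ℝ V]
    (B : E × V →L[ℝ] F) :
    Module.finrank ℝ ((ContinuousLinearMap.snd ℝ E V).prod B).ker
      = Module.finrank ℝ (B.comp (ContinuousLinearMap.inl ℝ E V)).ker := by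
  have h : ((ContinuousLinearMap.snd ℝ E V).prod B).ker
      = (B.comp (ContinuousLinearMap.inl ℝ E V)).ker.map (LinearMap.inl ℝ E V) := by
    ext ⟨ξ, v⟩
    constructor
    · intro h
      have h1 : v = 0 := congrArg Prod.fst h
      have h2 : B (ξ, v) = 0 := congrArg Prod.snd h
      subst h1
      exact ⟨ξ, h2, rfl⟩
    · rintro ⟨ξ', h1, h2⟩
      obtain ⟨rfl, rfl⟩ := Prod.mk.inj h2
      exact Prod.ext rfl h1
  rw [h]
  exact (Submodule.equivMapOfInjective _ LinearMap.inl_injective _).finrank_eq.symm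

end Kernels

/-! ### Differentials of orbit maps -/

/-- The differential of a map of manifolds, as a map of the model spaces. -/
noncomputable abbrev modelDeriv (E F : Type*) [NormedAddCommGroup E] [NormedSpace ℝ E]
    [NormedAddCommGroup F] [NormedSpace ℝ F] {M : Type*} [TopologicalSpace M] [ChartedSpace E M]
    {M' : Type*} [TopologicalSpace M'] [ChartedSpace F M'] (f : M → M') (x : M) : E →L[ℝ] F :=
  mfderiv 𝓘(ℝ, E) 𝓘(ℝ, F) f x

/-- The differential of a map of manifolds, computed in the preferred charts. -/
theorem mfderiv_eq_fderiv_extChartAt {E F : Type*} [NormedAddCommGroup E] [NormedSpace ℝ E]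
    [NormedAddCommGroup F] [NormedSpace ℝ F] {M : Type*} [TopologicalSpace M] [ChartedSpace E M]
    {M' : Type*} [TopologicalSpace M'] [ChartedSpace F M'] {f : M → M'} {x : M} {y : M'}
    (hf : MDifferentiableAt 𝓘(ℝ, E) 𝓘(ℝ, F) f x) (hy : f x = y) :
    modelDeriv E F f x =
      fderiv ℝ (fun z => extChartAt 𝓘(ℝ, F) y (f ((extChartAt 𝓘(ℝ, E) x).symm z)))
        (extChartAt 𝓘(ℝ, E) x x) := by
  subst hy
  rw [modelDeriv, hf.mfderiv]
  simp only [modelWithCornersSelf_coe, Set.range_id, fderivWithin_univ]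
  rfl

section Action

variable {EG : Type*} [NormedAddCommGroup EG] [NormedSpace ℝ EG]
  {G : Type*} [TopologicalSpace G] [ChartedSpace EG G] [Group G]
  {EN : Type*} [NormedAddCommGroup EN] [NormedSpace ℝ EN]
  {N : Type*} [TopologicalSpace N] [ChartedSpace EN N]
  [MulAction G N]

theorem contMDiff_orbitMap [ContMDiffSMul 𝓘(ℝ, EG) 𝓘(ℝ, EN) ∞ G N] (x : N) :
    ContMDiff 𝓘(ℝ, EG) 𝓘(ℝ, EN) ∞ (fun g : G => g • x) :=
  ContMDiff.smul (I := 𝓘(ℝ, EG)) contMDiff_id contMDiff_const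

variable (EG G EN) in
/-- The dimension of the stabiliser of `x`, as the dimension of the kernel of the differential
at `1` of the orbit map of `x`. -/
noncomputable def stabilizerDim (x : N) : ℕ :=
  Module.finrank ℝ (modelDeriv EG EN (fun g : G => g • x) 1).ker

variable (EG G EN) in
/-- The map `(ξ, y) ↦ ξ • p y`, in the charts of `G` at `1` and of `N` at `x`. -/
noncomputable def chartAction {V : Type*} (p : V → N) (x : N) (z : EG × V) : EN :=
  extChartAt 𝓘(ℝ, EN) x ((extChartAt 𝓘(ℝ, EG) (1 : G)).symm z.1 • p z.2)

theorem eventually_mem_chartAction [ContMDiffSMul 𝓘(ℝ, EG) 𝓘(ℝ, EN) ∞ G N]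
    {V : Type*} [TopologicalSpace V] {p : V → N} {x : N} (hp : Continuous p) {u : V} (hx : p u = x) :
    ∀ᶠ z : EG × V in 𝓝 (extChartAt 𝓘(ℝ, EG) (1 : G) 1, u),
      z.1 ∈ (extChartAt 𝓘(ℝ, EG) (1 : G)).target ∧
      (extChartAt 𝓘(ℝ, EG) (1 : G)).symm z.1 • p z.2 ∈ (extChartAt 𝓘(ℝ, EN) x).source := by
  have : ContinuousSMul G N := ContMDiffSMul.continuousSMul (I := 𝓘(ℝ, EG)) (I' := 𝓘(ℝ, EN)) ∞
  have h1 : ContinuousAt (fun z : EG × V => (extChartAt 𝓘(ℝ, EG) (1 : G)).symm z.1 • p z.2)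
      (extChartAt 𝓘(ℝ, EG) (1 : G) 1, u) :=
    (ContinuousAt.comp (g := (extChartAt 𝓘(ℝ, EG) (1 : G)).symm)
      (f := Prod.fst) (continuousAt_extChartAt_symm (1 : G)) continuousAt_fst).smul
      (hp.comp continuous_snd).continuousAt
  have h2 : ContinuousAt (Prod.fst : EG × V → EG) (extChartAt 𝓘(ℝ, EG) (1 : G) 1, u) :=
    continuousAt_fst
  refine (h2.eventually_mem (extChartAt_target_mem_nhds (I := 𝓘(ℝ, EG)) (1 : G))).and (h1.eventually_mem ?_)
  simp only [extChartAt_to_inv, one_smul, hx]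
  exact extChartAt_source_mem_nhds x

variable [LieGroup 𝓘(ℝ, EG) ∞ G] [ContMDiffSMul 𝓘(ℝ, EG) 𝓘(ℝ, EN) ∞ G N]

/-- The orbit map intertwines left translation by `g` with the action of `g` on `N`, both
diffeomorphisms. -/
theorem finrank_ker_mfderiv_orbitMap (g : G) (x : N) :
    Module.finrank ℝ (modelDeriv EG EN (fun h : G => h • x) g).ker
      = stabilizerDim EG G EN x := by
  let Φ : G ≃ₘ^∞⟮𝓘(ℝ, EG), 𝓘(ℝ, EG)⟯ G := Diffeomorph.smul 𝓘(ℝ, EG) 𝓘(ℝ, EG) ∞ g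
  let Ψ : N ≃ₘ^∞⟮𝓘(ℝ, EN), 𝓘(ℝ, EN)⟯ N := Diffeomorph.smul 𝓘(ℝ, EG) 𝓘(ℝ, EN) ∞ g
  have hΦ : Φ 1 = g := mul_one g
  have horb := fun h : G => (contMDiff_orbitMap (EG := EG) (EN := EN) x h).mdifferentiableAt
    (by simp : (∞ : WithTop ℕ∞) ≠ 0)
  have h1 := mfderiv_comp (1 : G) (horb (Φ 1)) (Φ.mdifferentiable (by simp) 1)
  have h2 := mfderiv_comp (1 : G) (Ψ.mdifferentiable (by simp) ((1 : G) • x)) (horb 1)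
  have h3 : (fun h : G => h • x) ∘ Φ = Ψ ∘ (fun h : G => h • x) :=
    funext fun h => mul_smul g h x
  rw [h3, h2, hΦ] at h1
  let eΦ : EG ≃L[ℝ] EG := Φ.mfderivToContinuousLinearEquiv (by simp) 1
  let eΨ : EN ≃L[ℝ] EN := Ψ.mfderivToContinuousLinearEquiv (by simp) ((1 : G) • x)
  exact (finrank_ker_eq_of_intertwining eΦ eΨ fun ξ =>
    (congrArg (fun A : EG →L[ℝ] EN => A ξ) h1).symm).symm

/-- The orbit map of `g • x` is that of `x` after right translation by `g`, which carries `1` to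
`g`. -/
theorem stabilizerDim_smul (g : G) (x : N) :
    stabilizerDim EG G EN (g • x) = stabilizerDim EG G EN x := by
  let Φ : G ≃ₘ^∞⟮𝓘(ℝ, EG), 𝓘(ℝ, EG)⟯ G :=
    { toEquiv := Equiv.mulRight g
      contMDiff_toFun := contMDiff_mul_right
      contMDiff_invFun := contMDiff_mul_right }
  have horb := fun h : G => (contMDiff_orbitMap (EG := EG) (EN := EN) x h).mdifferentiableAt
    (by simp : (∞ : WithTop ℕ∞) ≠ 0)
  have h1 := mfderiv_comp (1 : G) (horb (Φ 1)) (Φ.mdifferentiable (by simp) 1)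
  have h3 : (fun h : G => h • x) ∘ Φ = fun h : G => h • g • x :=
    funext fun h => mul_smul h g x
  rw [h3] at h1
  let eΦ : EG ≃L[ℝ] EG := Φ.mfderivToContinuousLinearEquiv (by simp) 1
  exact (finrank_ker_eq_of_intertwining eΦ (.refl ℝ EN) fun ξ =>
    (congrArg (fun A : EG →L[ℝ] EN => A ξ) h1).symm).trans (finrank_ker_mfderiv_orbitMap (Φ 1) x)

/-! ### The action in charts -/

section Chart

variable [IsManifold 𝓘(ℝ, EN) ∞ N] {V : Type*} [NormedAddCommGroup V] [NormedSpace ℝ V]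
  {p : V → N} {x : N}

theorem contDiffAt_chartAction (hp : ContMDiff 𝓘(ℝ, V) 𝓘(ℝ, EN) ∞ p) {z : EG × V}
    (hz : z.1 ∈ (extChartAt 𝓘(ℝ, EG) (1 : G)).target)
    (hzx : (extChartAt 𝓘(ℝ, EG) (1 : G)).symm z.1 • p z.2 ∈ (extChartAt 𝓘(ℝ, EN) x).source) :
    ContDiffAt ℝ ∞ (chartAction EG G EN p x) z := by
  rw [← contMDiffAt_iff_contDiffAt]
  have h1 : ContMDiffAt 𝓘(ℝ, EG) 𝓘(ℝ, EG) ∞ (extChartAt 𝓘(ℝ, EG) (1 : G)).symm z.1 :=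
    (contMDiffOn_extChartAt_symm (1 : G)).contMDiffAt
      ((isOpen_extChartAt_target (1 : G)).mem_nhds hz)
  have h2 : ContMDiffAt 𝓘(ℝ, EG × V) 𝓘(ℝ, EN) ∞
      (fun z : EG × V => (extChartAt 𝓘(ℝ, EG) (1 : G)).symm z.1 • p z.2) z :=
    ContMDiffAt.smul (I := 𝓘(ℝ, EG))
      (ContMDiffAt.comp z h1 contDiff_fst.contMDiff.contMDiffAt)
      (ContMDiffAt.comp z (hp.contMDiffAt (x := z.2)) contDiff_snd.contMDiff.contMDiffAt)
  exact ContMDiffAt.comp z (contMDiffAt_extChartAt' (by simpa using hzx)) h2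

/-- The partial differential in the group variable is that of an orbit map, composed with the
invertible differentials of the charts. -/
theorem finrank_ker_fderiv_chartAction (hp : ContMDiff 𝓘(ℝ, V) 𝓘(ℝ, EN) ∞ p) {z : EG × V}
    (hz : z.1 ∈ (extChartAt 𝓘(ℝ, EG) (1 : G)).target)
    (hzx : (extChartAt 𝓘(ℝ, EG) (1 : G)).symm z.1 • p z.2 ∈ (extChartAt 𝓘(ℝ, EN) x).source) :
    Module.finrank ℝ ((fderiv ℝ (chartAction EG G EN p x) z).comp
        (ContinuousLinearMap.inl ℝ EG V)).ker = stabilizerDim EG G EN (p z.2) := by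
  obtain ⟨ξ, y⟩ := z
  have hA := (contDiffAt_chartAction hp hz hzx).differentiableAt (by simp)
  have h1 : HasFDerivAt (fun ξ => chartAction EG G EN p x (ξ, y))
      ((fderiv ℝ (chartAction EG G EN p x) (ξ, y)).comp (ContinuousLinearMap.inl ℝ EG V)) ξ :=
    HasFDerivAt.comp ξ (g := chartAction EG G EN p x) (f := fun ξ => (ξ, y)) hA.hasFDerivAt
      (hasFDerivAt_prodMk_left ξ y)
  rw [← h1.fderiv]
  have hs := isInvertible_mfderivWithin_extChartAt_symm (I := 𝓘(ℝ, EG)) hz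
  have ht := isInvertible_mfderiv_extChartAt (I := 𝓘(ℝ, EN)) hzx
  rw [modelWithCornersSelf_coe, Set.range_id, mfderivWithin_univ] at hs
  obtain ⟨eS, heS⟩ := hs
  obtain ⟨eT, heT⟩ := ht
  have hsd : MDifferentiableAt 𝓘(ℝ, EG) 𝓘(ℝ, EG) (extChartAt 𝓘(ℝ, EG) (1 : G)).symm ξ :=
    ((contMDiffOn_extChartAt_symm (n := ∞) (1 : G)).contMDiffAt
      ((isOpen_extChartAt_target (1 : G)).mem_nhds hz)).mdifferentiableAt (by simp)
  have htd : MDifferentiableAt 𝓘(ℝ, EN) 𝓘(ℝ, EN) (extChartAt 𝓘(ℝ, EN) x)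
      ((extChartAt 𝓘(ℝ, EG) (1 : G)).symm ξ • p y) :=
    (contMDiffAt_extChartAt' (n := ∞) (by simpa using hzx)).mdifferentiableAt (by simp)
  have hod := (contMDiff_orbitMap (EG := EG) (EN := EN) (p y)
    ((extChartAt 𝓘(ℝ, EG) (1 : G)).symm ξ)).mdifferentiableAt (by simp)
  have h2 := (htd.hasMFDerivAt.comp ξ (hod.hasMFDerivAt.comp ξ hsd.hasMFDerivAt)).mfderiv
  rw [mfderiv_eq_fderiv] at h2
  rw [← heS, ← heT] at h2
  let eS' : EG ≃L[ℝ] EG := eS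
  let eT' : EN ≃L[ℝ] EN := eT
  exact (finrank_ker_eq_of_intertwining eS' eT'.symm fun ξ' =>
    (eT'.symm_apply_eq.2 (congrArg (fun A : EG →L[ℝ] EN => A ξ') h2)).symm).trans
    (finrank_ker_mfderiv_orbitMap ((extChartAt 𝓘(ℝ, EG) (1 : G)).symm ξ) (p y))

end Chart

end Action

/-! ### Plots with the same projection to the orbit space -/

section Generic

variable {EG : Type*} [NormedAddCommGroup EG] [NormedSpace ℝ EG] [FiniteDimensional ℝ EG]
  {G : Type*} [TopologicalSpace G] [ChartedSpace EG G] [Group G] [LieGroup 𝓘(ℝ, EG) ∞ G]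
  {EN : Type*} [NormedAddCommGroup EN] [NormedSpace ℝ EN]
  {N : Type*} [TopologicalSpace N] [ChartedSpace EN N] [IsManifold 𝓘(ℝ, EN) ∞ N]
  [MulAction G N] [ContMDiffSMul 𝓘(ℝ, EG) 𝓘(ℝ, EN) ∞ G N]
  {V : Type*} [NormedAddCommGroup V] [NormedSpace ℝ V]

theorem eventually_stabilizerDim_le {p : V → N} (hp : ContMDiff 𝓘(ℝ, V) 𝓘(ℝ, EN) ∞ p) (u : V) :
    ∀ᶠ y in 𝓝 u, stabilizerDim EG G EN (p y) ≤ stabilizerDim EG G EN (p u) := by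
  let a : EG := extChartAt 𝓘(ℝ, EG) (1 : G) 1
  have hmem := eventually_mem_chartAction (EG := EG) (G := G) (EN := EN) hp.continuous
    (rfl : p u = p u)
  have hy : Filter.Tendsto (fun y : V => (a, y)) (𝓝 u) (𝓝 (a, u)) :=
    (Continuous.prodMk_right a).continuousAt
  have hA : ContinuousAt (fun y => (fderiv ℝ (chartAction EG G EN p (p u)) (a, y)).comp
      (ContinuousLinearMap.inl ℝ EG V)) u := by
    have h1 := (contDiffAt_chartAction hp hmem.self_of_nhds.1
      hmem.self_of_nhds.2).continuousAt_fderiv (by simp)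
    exact (h1.comp_of_eq hy rfl).clm_comp continuousAt_const
  filter_upwards [eventually_finrank_ker_le hA, hy.eventually hmem] with y h1 h2
  rwa [finrank_ker_fderiv_chartAction hp h2.1 h2.2,
    finrank_ker_fderiv_chartAction hp hmem.self_of_nhds.1 hmem.self_of_nhds.2] at h1

/-- Two plots that agree at `u` and that are related, near `u`, by group elements close to `1`,
have the same velocities at `u` up to vectors tangent to the orbit, provided that the dimension
of the stabiliser is minimal at `u`. -/
theorem exists_mfderiv_eq_add_of_near_one [FiniteDimensional ℝ EN] [FiniteDimensional ℝ V]
    {p q : V → N}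
    (hp : ContMDiff 𝓘(ℝ, V) 𝓘(ℝ, EN) ∞ p) (hq : ContMDiff 𝓘(ℝ, V) 𝓘(ℝ, EN) ∞ q) {u : V}
    (hu : p u = q u)
    (hdim : ∀ᶠ y in 𝓝 u, stabilizerDim EG G EN (p u) ≤ stabilizerDim EG G EN (p y))
    (hlift : ∀ s ∈ 𝓝 (1 : G), ∀ᶠ y in 𝓝 u, ∃ g ∈ s, g • p y = q y) (v : V) :
    ∃ ξ : EG, modelDeriv V EN q u v
      = modelDeriv V EN p u v
        + modelDeriv EG EN (fun g : G => g • q u) 1 ξ := by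
  let x := q u
  let φ := extChartAt 𝓘(ℝ, EN) x
  let ch := extChartAt 𝓘(ℝ, EG) (1 : G)
  let a : EG := ch 1
  let f₀ : EG × V → EN := chartAction EG G EN p x
  have hch : ch.symm a = 1 := extChartAt_to_inv (I := 𝓘(ℝ, EG)) (1 : G)
  have hmem := eventually_mem_chartAction (EG := EG) (G := G) (EN := EN) hp.continuous hu
  have hf₀ : ContDiffAt ℝ ∞ f₀ (a, u) :=
    contDiffAt_chartAction hp hmem.self_of_nhds.1 hmem.self_of_nhds.2
  -- Keeping `y` as a component makes the kernel of `df` vertical, of dimension `stabilizerDim` at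
  -- `p y`, and forces a lift of `(y, φ (q y))` to lie over `y`.
  let f : EG × V → V × EN := fun z => (z.2, f₀ z)
  have hf : ContDiffAt ℝ 1 f (a, u) := contDiffAt_snd.prodMk (hf₀.of_le (by simp))
  have hfd : ∀ z, DifferentiableAt ℝ f₀ z →
      HasFDerivAt f ((ContinuousLinearMap.snd ℝ EG V).prod (fderiv ℝ f₀ z)) z := fun z hz =>
    hasFDerivAt_snd.prodMk hz.hasFDerivAt
  have hdimz : ∀ᶠ z in 𝓝 (a, u), Module.finrank ℝ (fderiv ℝ f z).ker
      = stabilizerDim EG G EN (p z.2) := by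
    filter_upwards [hmem] with z hz
    rw [(hfd z ((contDiffAt_chartAction hp hz.1 hz.2).differentiableAt (by simp))).fderiv,
      finrank_ker_snd_prod]
    exact finrank_ker_fderiv_chartAction hp hz.1 hz.2
  have hker : ∀ᶠ z in 𝓝 (a, u), Module.finrank ℝ (fderiv ℝ f (a, u)).ker
      ≤ Module.finrank ℝ (fderiv ℝ f z).ker := by
    have h1 : ContinuousAt (Prod.snd : EG × V → V) (a, u) := continuousAt_snd
    filter_upwards [hdimz, h1.eventually hdim] with z h2 h3
    rw [hdimz.self_of_nhds, h2]
    exact h3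
  have hqd : MDifferentiableAt 𝓘(ℝ, V) 𝓘(ℝ, EN) q u := (hq u).mdifferentiableAt (by simp)
  have hpd : MDifferentiableAt 𝓘(ℝ, V) 𝓘(ℝ, EN) p u := (hp u).mdifferentiableAt (by simp)
  have hchart : ∀ {r : V → N}, MDifferentiableAt 𝓘(ℝ, V) 𝓘(ℝ, EN) r u → r u = x →
      HasFDerivAt (fun y => φ (r y)) (modelDeriv V EN r u) u := by
    intro r hr hx
    rw [mfderiv_eq_fderiv_extChartAt hr hx]
    refine DifferentiableAt.hasFDerivAt (f := fun y => φ (r y)) ?_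
    have h1 : MDifferentiableAt 𝓘(ℝ, EN) 𝓘(ℝ, EN) φ (r u) := by
      rw [hx]
      exact (contMDiffAt_extChartAt (n := ∞)).mdifferentiableAt (by simp)
    exact (h1.comp u hr).differentiableAt
  have hc : HasFDerivAt (fun y => (y, φ (q y))) ((ContinuousLinearMap.id ℝ V).prod
      (modelDeriv V EN q u)) u :=
    (hasFDerivAt_id u).prodMk (hchart hqd rfl)
  have hfa : f (a, u) = (u, φ (q u)) := by
    change (u, φ (ch.symm a • p u)) = _
    rw [hch, one_smul, hu]
  obtain ⟨⟨ξ, w⟩, hξ⟩ := exists_fderiv_eq_of_finrank_ker_le hf hker hc hfa.symm (fun s hs => by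
    obtain ⟨s₁, hs₁, s₂, hs₂, hs₁₂⟩ := mem_nhds_prod_iff.1 hs
    have h1 : ch ⁻¹' s₁ ∩ ch.source ∈ 𝓝 (1 : G) := Filter.inter_mem
      ((continuousAt_extChartAt (1 : G)).preimage_mem_nhds hs₁)
      (extChartAt_source_mem_nhds (1 : G))
    filter_upwards [hlift _ h1, hs₂] with y ⟨g, ⟨hg1, hg2⟩, hg⟩ hy
    refine ⟨(ch g, y), hs₁₂ ⟨hg1, hy⟩, ?_⟩
    change _ = (y, φ (ch.symm (ch g) • p y))
    rw [ch.left_inv hg2, hg]) v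
  have hf₀d : HasFDerivAt f₀ (fderiv ℝ f₀ (a, u)) (a, u) :=
    (hf₀.differentiableAt (by simp)).hasFDerivAt
  rw [(hfd _ hf₀d.differentiableAt).fderiv] at hξ
  have hw : v = w := congrArg Prod.fst hξ
  have hξ2 : modelDeriv V EN q u v = fderiv ℝ f₀ (a, u) (ξ, w) :=
    congrArg Prod.snd hξ
  subst hw
  refine ⟨ξ, ?_⟩
  have hod := (contMDiff_orbitMap (EG := EG) (EN := EN) x (1 : G)).mdifferentiableAt
    (by simp : (∞ : WithTop ℕ∞) ≠ 0)
  have h1 : HasFDerivAt (fun ξ => f₀ (ξ, u))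
      ((fderiv ℝ f₀ (a, u)).comp (ContinuousLinearMap.inl ℝ EG V)) a :=
    HasFDerivAt.comp a (g := f₀) (f := fun ξ => (ξ, u)) hf₀d (hasFDerivAt_prodMk_left a u)
  have h2 : HasFDerivAt (fun y => f₀ (a, y))
      ((fderiv ℝ f₀ (a, u)).comp (ContinuousLinearMap.inr ℝ EG V)) u :=
    HasFDerivAt.comp u (g := f₀) (f := fun y => (a, y)) hf₀d (hasFDerivAt_prodMk_right a u)
  have h3 : (fun y => f₀ (a, y)) = fun y => φ (p y) := funext fun y => by
    change φ (ch.symm a • p y) = _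
    rw [hch, one_smul]
  rw [h3] at h2
  have h4 : modelDeriv EG EN (fun g : G => g • x) 1
      = (fderiv ℝ f₀ (a, u)).comp (ContinuousLinearMap.inl ℝ EG V) := by
    rw [mfderiv_eq_fderiv_extChartAt hod (one_smul G x), ← h1.fderiv]
    simp only [f₀, chartAction, hu]
    rfl
  rw [hξ2, h4, (hchart hpd hu).unique h2]
  change fderiv ℝ f₀ (a, u) (ξ, v) = fderiv ℝ f₀ (a, u) (0, v) + fderiv ℝ f₀ (a, u) (ξ, 0)
  rw [← map_add, Prod.mk_add_mk, zero_add, add_zero]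

/-- Two plots with the same projection to the orbit space have, at a generic point and up to the
action, the same velocities modulo vectors tangent to the orbit. -/
theorem dense_setOf_mfderiv_eq_add [T2Space G] [SecondCountableTopology G] [T2Space N]
    [FiniteDimensional ℝ EN] [FiniteDimensional ℝ V] {p q : V → N}
    (hp : ContMDiff 𝓘(ℝ, V) 𝓘(ℝ, EN) ∞ p) (hq : ContMDiff 𝓘(ℝ, V) 𝓘(ℝ, EN) ∞ q)
    (hpq : ∀ y, ∃ g : G, g • p y = q y) :
    Dense {u : V | ∃ g : G, g • p u = q u ∧ ∀ v : V, ∃ ξ : EG,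
      modelDeriv V EN q u v
        = modelDeriv V EN (fun y => g • p y) u v
          + modelDeriv EG EN (fun g : G => g • q u) 1 ξ} := by
  have : LocallyCompactSpace G := Manifold.locallyCompact_of_finiteDimensional 𝓘(ℝ, EG)
  have : ContinuousSMul G N := ContMDiffSMul.continuousSMul (I := 𝓘(ℝ, EG)) (I' := 𝓘(ℝ, EN)) ∞
  have : ContinuousMul G := continuousMul_of_contMDiffMul 𝓘(ℝ, EG) ∞
  have hZ : IsClosed {z : G × V | z.1 • p z.2 = q z.2} :=
    isClosed_eq (continuous_fst.smul (hp.continuous.comp continuous_snd))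
      (hq.continuous.comp continuous_snd)
  have hD := dense_setOf_eventually_exists_mem hZ
  rw [dense_iff_inter_open]
  intro U hU hUne
  -- Near a minimiser over `U`, semicontinuity makes the stabiliser dimension constant; the
  -- Baire-generic point is then picked there.
  obtain ⟨_, ⟨u₀, hu₀, rfl⟩, hmin⟩ := WellFounded.has_min (wellFounded_lt (α := ℕ))
    ((fun y => stabilizerDim EG G EN (p y)) '' U) (hUne.image _)
  have hge : ∀ y ∈ U, stabilizerDim EG G EN (p u₀) ≤ stabilizerDim EG G EN (p y) := fun y hy =>
    not_lt.1 (hmin _ ⟨y, hy, rfl⟩)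
  obtain ⟨W, hW, hWo, hu₀W⟩ := mem_nhds_iff.1
    (Filter.inter_mem (eventually_stabilizerDim_le (EG := EG) (G := G) hp u₀) (hU.mem_nhds hu₀))
  obtain ⟨u, huW, huD⟩ := hD.inter_open_nonempty W hWo ⟨u₀, hu₀W⟩
  obtain ⟨g, hg⟩ := hpq u
  have hgp : ContMDiff 𝓘(ℝ, V) 𝓘(ℝ, EN) ∞ (fun y => g • p y) :=
    ContMDiff.smul (I := 𝓘(ℝ, EG)) contMDiff_const hp
  refine ⟨u, (hW huW).2, g, hg,
    exists_mfderiv_eq_add_of_near_one (EG := EG) hgp hq hg ?_ fun s hs => ?_⟩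
  · filter_upwards [hU.mem_nhds (hW huW).2] with y hy
    rw [stabilizerDim_smul, stabilizerDim_smul]
    exact (hW huW).1.trans (hge y hy)
  -- Replacing `p` by `g • p` turns elements near `g` into elements near `1`.
  · have h1 : (fun h : G => h * g⁻¹) ⁻¹' s ∈ 𝓝 g :=
      (continuous_mul_const g⁻¹).continuousAt.preimage_mem_nhds (by simpa using hs)
    filter_upwards [huD g hg _ h1] with y ⟨h, hhs, hh⟩
    refine ⟨h * g⁻¹, hhs, ?_⟩
    rw [smul_smul, inv_mul_cancel_right]
    exact hh

end Generic

/-! ### Basic forms on a manifold -/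

/-- An alternating form which vanishes as soon as one argument lies in `T` only depends on its
arguments modulo `T`. -/
theorem map_eq_of_sub_mem {E : Type*} [NormedAddCommGroup E] [NormedSpace ℝ E] {k : ℕ}
    (A : E [⋀^Fin k]→L[ℝ] ℝ) {T : Set E} (hT : ∀ (w : Fin k → E) (i : Fin k), w i ∈ T → A w = 0)
    {a b : Fin k → E} (hab : ∀ i, a i - b i ∈ T) : A a = A b := by
  -- The arguments are exchanged one at a time.
  have key : ∀ s : Finset (Fin k), A (s.piecewise a b) = A b := by
    intro s
    induction s using Finset.induction_on with
    | empty => rw [Finset.piecewise_empty]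
    | insert i s hi ih =>
      rw [Finset.piecewise_insert, ← ih]
      have h1 := A.map_update_sub (s.piecewise a b) i (a i) (b i)
      rw [hT _ i (by rw [Function.update_self]; exact hab i)] at h1
      have h2 : Function.update (s.piecewise a b) i (b i) = s.piecewise a b := by
        rw [Function.update_eq_self_iff, Finset.piecewise_eq_of_notMem _ _ _ hi]
      rw [h2] at h1
      exact (sub_eq_zero.1 h1.symm)
  simpa using key Finset.univ

/-- A manifold has a plot which is a submersion at a given point. -/
theorem exists_plot_surjective (EN : Type*) [NormedAddCommGroup EN] [NormedSpace ℝ EN]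
    [FiniteDimensional ℝ EN] {N : Type*} [TopologicalSpace N] [ChartedSpace EN N]
    [IsManifold 𝓘(ℝ, EN) ∞ N] [DiffeologicalSpace N] [IsManifoldDiffeology EN N] (x : N) :
    ∃ (d : ℕ) (ψ : Euc d → N) (s : Euc d), IsPlot ψ ∧ ψ s = x ∧
      Function.Surjective (modelDeriv (Euc d) EN ψ s) := by
  let φ := extChartAt 𝓘(ℝ, EN) x
  let e : EN ≃L[ℝ] Euc (Module.finrank ℝ EN) := toEuclidean
  have ht : e.symm ⁻¹' φ.target ∈ 𝓝 (e (φ x)) := by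
    apply e.symm.continuous.continuousAt.preimage_mem_nhds
    rw [e.symm_apply_apply]
    exact extChartAt_target_mem_nhds (I := 𝓘(ℝ, EN)) x
  obtain ⟨r, hr, hrt, hrx⟩ := exists_cutoff ht
  let ψ : Euc (Module.finrank ℝ EN) → N := fun y => φ.symm (e.symm (r y))
  have hψ : ContMDiff 𝓘(ℝ, Euc (Module.finrank ℝ EN)) 𝓘(ℝ, EN) ∞ ψ := by
    have h1 : ContMDiffOn 𝓘(ℝ, EN) 𝓘(ℝ, EN) ∞ φ.symm φ.target := contMDiffOn_extChartAt_symm x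
    exact h1.comp_contMDiff (e.symm.contDiff.comp hr).contMDiff hrt
  have hψx : ψ (e (φ x)) = x := by
    have h1 : r (e (φ x)) = e (φ x) := hrx.self_of_nhds
    simp only [ψ, h1, e.symm_apply_apply]
    exact extChartAt_to_inv (I := 𝓘(ℝ, EN)) x
  refine ⟨_, ψ, e (φ x), (IsManifoldDiffeology.isPlot_iff (E := EN)).2 hψ, hψx, ?_⟩
  have h2 : (fun y => φ (ψ y)) =ᶠ[𝓝 (e (φ x))] e.symm := by
    filter_upwards [hrx] with y hy
    have hy' : r y = y := hy
    change φ (φ.symm (e.symm (r y))) = _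
    rw [φ.right_inv (hrt y), hy']
  rw [mfderiv_eq_fderiv_extChartAt ((hψ _).mdifferentiableAt (by simp)) hψx]
  change Function.Surjective (fderiv ℝ (fun y => φ (ψ y)) (e (φ x)))
  rw [h2.fderiv_eq, e.symm.fderiv]
  exact e.symm.surjective

section Manifold

variable {EG : Type*} [NormedAddCommGroup EG] [NormedSpace ℝ EG] [FiniteDimensional ℝ EG]
  {G : Type*} [TopologicalSpace G] [ChartedSpace EG G] [Group G] [LieGroup 𝓘(ℝ, EG) ∞ G]
  [T2Space G] [SecondCountableTopology G]
  {N : Type*} [TopologicalSpace N] [T2Space N] [DiffeologicalSpace N] [MulAction G N]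
  {k n : ℕ} {α : DForm N k}

/-- A basic form takes the same values on plots with the same projection to the orbit space. -/
theorem toFun_eq_of_mem_basicForms (EN : Type*) [NormedAddCommGroup EN] [NormedSpace ℝ EN]
    [FiniteDimensional ℝ EN] [ChartedSpace EN N] [IsManifold 𝓘(ℝ, EN) ∞ N]
    [IsManifoldDiffeology EN N] [ContMDiffSMul 𝓘(ℝ, EG) 𝓘(ℝ, EN) ∞ G N]
    (hα : α ∈ basicForms EG G N k) {p q : Euc n → N}
    (hp : IsPlot p) (hq : IsPlot q) (hpq : ∀ y, ∃ g : G, g • p y = q y) :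
    α.toFun p hp = α.toFun q hq := by
  refine (α.smooth p hp).continuous.ext_on (dense_setOf_mfderiv_eq_add (EG := EG)
    ((IsManifoldDiffeology.isPlot_iff (E := EN)).1 hp)
    ((IsManifoldDiffeology.isPlot_iff (E := EN)).1 hq) hpq) (α.smooth q hq).continuous ?_
  rintro u ⟨g, hg, hd⟩
  have hgs : DSmooth (fun x : N => g • x) := dSmooth_smul_manifold (E := EG) (F := EN) g
  have hinv : α.toFun p hp = α.toFun (fun y => g • p y) (hp.dSmooth_comp hgs) :=
    (congrArg (fun β : DForm N k => β.toFun p hp) (hα.2 g hgs)).symm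
  rw [hinv]
  obtain ⟨A, hA⟩ := α.eq_chart (E := EN) (q u)
  ext v
  rw [hA n _ _ u hg, hA n q hq u rfl]
  refine (map_eq_of_sub_mem A (T := Set.range (modelDeriv EG EN (fun g : G => g • q u) 1)) ?_
    fun i => ?_).symm
  · rintro w i ⟨ξ, hξ⟩
    -- Horizontality is a statement about plots; on a submersive plot every tuple of tangent vectors
    -- is a tuple of velocities.
    obtain ⟨d, ψ, s, hψ, hψs, hsurj⟩ := exists_plot_surjective EN (q u)
    choose w' hw' using fun j => hsurj (w j)
    have h1 := (isHorizontal_iff_mfderiv (E := EN) α).1 hα.1 d ψ hψ s (w' i) ξ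
      (by rw [hψs]; exact (hw' i).trans hξ.symm) w' i rfl
    rw [hA d ψ hψ s hψs] at h1
    rw [← h1]
    exact congrArg A (funext fun j => (hw' j).symm)
  · obtain ⟨ξ, hξ⟩ := hd (v i)
    exact ⟨ξ, (sub_eq_of_eq_add' hξ).symm⟩

/-- A horizontal form vanishes when one argument is the velocity of a curve that stays in an
orbit. -/
theorem toFun_eq_zero_of_line_mem_orbit (EN : Type*) [NormedAddCommGroup EN] [NormedSpace ℝ EN]
    [FiniteDimensional ℝ EN] [ChartedSpace EN N] [IsManifold 𝓘(ℝ, EN) ∞ N]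
    [IsManifoldDiffeology EN N] [ContMDiffSMul 𝓘(ℝ, EG) 𝓘(ℝ, EN) ∞ G N]
    (hα : α.IsHorizontal EG G) {q : Euc n → N}
    (hq : IsPlot q) {u w : Euc n} (h : ∀ᶠ t in 𝓝 (0 : ℝ), ∃ g : G, g • q u = q (u + t • w))
    {v : Fin k → Euc n} {i : Fin k} (hv : v i = w) : α.toFun q hq u v = 0 := by
  have hq' := (IsManifoldDiffeology.isPlot_iff (E := EN)).1 hq
  let π : Euc 1 →L[ℝ] ℝ := EuclideanSpace.proj 0
  let ℓ : Euc 1 → Euc n := fun s => u + π s • w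
  have hℓ : ContDiff ℝ ∞ ℓ := contDiff_const.add (π.contDiff.smul contDiff_const)
  have hℓd : ∀ s, HasFDerivAt ℓ (π.smulRight w) s := fun s =>
    (π.hasFDerivAt.smul_const w).const_add u
  have hℓ0 : ℓ 0 = u := by simp [ℓ]
  have hS : {s : Euc 1 | ∃ g : G, g • q u = q (ℓ s)} ∈ 𝓝 (0 : Euc 1) := by
    have h1 : Filter.Tendsto π (𝓝 0) (𝓝 0) := by simpa using π.continuous.tendsto 0
    exact h1.eventually h
  obtain ⟨r, hr, hrS, hr0⟩ := exists_cutoff hS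
  have hqr : ContMDiff 𝓘(ℝ, Euc 1) 𝓘(ℝ, EN) ∞ (fun s => q (ℓ (r s))) :=
    hq'.comp (hℓ.comp hr).contMDiff
  -- The curve is compared with a constant plot, whose velocity is zero; so at generic times its
  -- velocity is tangent to the orbit.
  have hD := dense_setOf_mfderiv_eq_add (EG := EG) (G := G) (p := fun _ : Euc 1 => q u)
    contMDiff_const hqr hrS
  have hcont : Continuous fun s => α.toFun q hq (ℓ s) v :=
    (ContinuousEvalConst.continuous_eval_const v).comp
      ((α.smooth q hq).continuous.comp hℓ.continuous)
  -- A nonzero value at `0` would persist nearby, hence at a generic time, where horizontality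
  -- forces zero.
  by_contra hne
  have hne' : ∀ᶠ s in 𝓝 (0 : Euc 1), α.toFun q hq (ℓ s) v ≠ 0 :=
    hcont.continuousAt.eventually_ne (by rwa [hℓ0])
  obtain ⟨s, ⟨g, -, hd⟩, hs, hrs⟩ := ((mem_closure_iff_frequently.1 (hD 0)).and_eventually
    (hne'.and hr0.eventuallyEq_nhds)).exists
  obtain ⟨ξ, hξ⟩ := hd (EuclideanSpace.single 0 1)
  have hrss : r s = s := hrs.self_of_nhds
  refine hs ((isHorizontal_iff_mfderiv (E := EN) α).1 hα n q hq (ℓ s) w ξ ?_ v i hv)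
  have h1 : modelDeriv (Euc 1) EN (fun _ : Euc 1 => g • q u) s = 0 := mfderiv_const
  have h2 : (fun s => q (ℓ (r s))) =ᶠ[𝓝 s] q ∘ ℓ := by
    filter_upwards [hrs] with y hy
    exact congrArg (fun z => q (ℓ z)) hy
  have h3 : modelDeriv (Euc 1) EN (fun s => q (ℓ (r s))) s
      = (modelDeriv (Euc n) EN q (ℓ s)).comp (π.smulRight w) :=
    h2.mfderiv_eq.trans (((hq' (ℓ s)).mdifferentiableAt (by simp)).hasMFDerivAt.comp s
      (hℓd s).hasMFDerivAt).mfderiv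
  rw [h1, h3, hrss] at hξ
  have hξ' : modelDeriv (Euc n) EN q (ℓ s) w
      = modelDeriv EG EN (fun g : G => g • q (ℓ s)) 1 ξ := by simpa [π] using hξ
  exact hξ'

end Manifold

/-! ### Basic forms and quotient in stages -/

/-- The projection is equivariant, so it carries curves `g t • x` to curves of the same kind, with
the same `g`. -/
theorem orbitPullback_mem_basicForms {EG : Type*} [NormedAddCommGroup EG] [NormedSpace ℝ EG]
    {G : Type*} [TopologicalSpace G] [ChartedSpace EG G] [Group G]
    {N : Type*} [DiffeologicalSpace N] [MulAction G N] (K : Subgroup G) [K.Normal] {k : ℕ}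
    {β : DForm (MulAction.orbitRel.Quotient K N) k}
    (hβ : β ∈ basicForms EG G (MulAction.orbitRel.Quotient K N) k) :
    orbitPullback K N k β ∈ basicForms EG G N k := by
  refine ⟨fun n p hp u w ⟨g, hg, hg0, hgp⟩ v i hv => ?_, fun g hg => ?_⟩
  · refine hβ.1 n (orbitProj K N ∘ p) (hp.dSmooth_comp (dSmooth_orbitProj K N)) u w
      ⟨g, hg, hg0, ?_⟩ v i hv
    filter_upwards [hgp] with t ht
    exact congrArg (orbitProj K N) ht
  · exact congrArg (orbitPullback K N k) (hβ.2 g (dSmooth_smul_orbitSpace K g hg))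

section Stages

variable {EG : Type*} [NormedAddCommGroup EG] [NormedSpace ℝ EG] [FiniteDimensional ℝ EG]
  {G : Type*} [TopologicalSpace G] [ChartedSpace EG G] [Group G] [LieGroup 𝓘(ℝ, EG) ∞ G]
  [T2Space G] [SecondCountableTopology G]
  {N : Type*} [TopologicalSpace N] [T2Space N] [DiffeologicalSpace N] [MulAction G N]
  (K : Subgroup G) [K.Normal]

theorem mem_basicForms_of_orbitPullback_mem (EN : Type*) [NormedAddCommGroup EN] [NormedSpace ℝ EN]
    [FiniteDimensional ℝ EN] [ChartedSpace EN N] [IsManifold 𝓘(ℝ, EN) ∞ N]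
    [IsManifoldDiffeology EN N] [ContMDiffSMul 𝓘(ℝ, EG) 𝓘(ℝ, EN) ∞ G N]
    {k : ℕ} {β : DForm (MulAction.orbitRel.Quotient K N) k}
    (hβ : orbitPullback K N k β ∈ basicForms EG G N k) :
    β ∈ basicForms EG G (MulAction.orbitRel.Quotient K N) k := by
  refine ⟨fun n p hp u w ⟨g, _, _, hgp⟩ v i hv => ?_, fun g hg => ?_⟩
  · obtain ⟨q, hq, hpq⟩ := IsPlot.exists_lift hp u
    have hpq' : p =ᶠ[𝓝 u] orbitProj K N ∘ q := hpq
    rw [β.congr_germ hp (hq.dSmooth_comp (dSmooth_orbitProj K N)) hpq']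
    refine toFun_eq_zero_of_line_mem_orbit EN hβ.1 hq (w := w) ?_ hv
    have hline : Filter.Tendsto (fun t : ℝ => u + t • w) (𝓝 0) (𝓝 u) := by
      have : Continuous fun t : ℝ => u + t • w := by fun_prop
      simpa using this.tendsto 0
    filter_upwards [hgp, hline.eventually hpq'] with t h1 h2
    have h3 : orbitProj K N (q (u + t • w)) = orbitProj K N (g t • q u) := by
      have h4 : p u = orbitProj K N (q u) := hpq'.self_of_nhds
      rw [h4, smul_orbitProj] at h1
      exact h2.symm.trans h1
    -- Here `κ` depends on `t` arbitrarily; only membership in the `G`-orbit is retained.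
    obtain ⟨κ, hκ⟩ := orbitProj_eq_iff.1 h3
    exact ⟨κ * g t, (mul_smul _ _ _).trans hκ⟩
  · have hgs : DSmooth (fun x : N => g • x) := dSmooth_smul_manifold (E := EG) (F := EN) g
    exact orbitPullback_injective K N k (hβ.2 g hgs)

theorem bijOn_basicForms_orbitPullback (EN : Type*) [NormedAddCommGroup EN] [NormedSpace ℝ EN]
    [FiniteDimensional ℝ EN] [ChartedSpace EN N] [IsManifold 𝓘(ℝ, EN) ∞ N]
    [IsManifoldDiffeology EN N] [ContMDiffSMul 𝓘(ℝ, EG) 𝓘(ℝ, EN) ∞ G N]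
    (k : ℕ) :
    Set.BijOn (orbitPullback K N k)
      (basicForms EG G (MulAction.orbitRel.Quotient K N) k) (basicForms EG G N k) := by
  refine ⟨fun β hβ => orbitPullback_mem_basicForms K hβ,
    (orbitPullback_injective K N k).injOn, fun α hα => ?_⟩
  obtain ⟨β, hβ⟩ := exists_pullback_quotientMk_eq (MulAction.orbitRel K N) α
    -- Plots with the same projection to `N/K` are in particular related by elements of `G`.
    fun n p q hp hq hpq => toFun_eq_of_mem_basicForms EN hα hp hq fun y => by
      obtain ⟨κ, hκ⟩ := orbitProj_eq_iff.1 (congrFun hpq.symm y)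
      exact ⟨κ, hκ⟩
  have hβ' : orbitPullback K N k β = α := hβ
  exact ⟨β, mem_basicForms_of_orbitPullback_mem K EN (hβ'.symm ▸ hα), hβ'⟩

end Stages

end QuotientInStages

open QuotientInStages in
theorem lemma4p1
    -- the Lie group `G`
    {EG : Type*} [NormedAddCommGroup EG] [NormedSpace ℝ EG] [FiniteDimensional ℝ EG]
    {G : Type*} [TopologicalSpace G] [ChartedSpace EG G] [Group G] [LieGroup 𝓘(ℝ, EG) ∞ G]
    [T2Space G] [SecondCountableTopology G]
    -- the manifold `N` with its standard diffeology
    {EN : Type*} [NormedAddCommGroup EN] [NormedSpace ℝ EN] [FiniteDimensional ℝ EN]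
    {N : Type*} [TopologicalSpace N] [ChartedSpace EN N] [IsManifold 𝓘(ℝ, EN) ∞ N]
    [T2Space N] [SecondCountableTopology N]
    [DiffeologicalSpace N] [IsManifoldDiffeology EN N]
    -- the smooth action
    [MulAction G N] [ContMDiffSMul 𝓘(ℝ, EG) 𝓘(ℝ, EN) ∞ G N]
    -- the normal Lie subgroup `K`, the image of the injective Lie group homomorphism `ι`
    (K : Subgroup G) [K.Normal]
    {EL : Type*} [NormedAddCommGroup EL] [NormedSpace ℝ EL] [FiniteDimensional ℝ EL]
    {L : Type*} [TopologicalSpace L] [ChartedSpace EL L] [Group L] [LieGroup 𝓘(ℝ, EL) ∞ L]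
    [T2Space L] [SecondCountableTopology L]
    (ι : L →* G) (hι : ContMDiff 𝓘(ℝ, EL) 𝓘(ℝ, EG) ∞ ι) (hι_inj : Function.Injective ι)
    (hι_range : ι.range = K) :
    (∃! e : MulAction.orbitRel.Quotient G N →
        MulAction.orbitRel.Quotient G (MulAction.orbitRel.Quotient K N),
      e ∘ orbitProj G N = orbitProj G (MulAction.orbitRel.Quotient K N) ∘ orbitProj K N) ∧
    (∀ e : MulAction.orbitRel.Quotient G N →
        MulAction.orbitRel.Quotient G (MulAction.orbitRel.Quotient K N),
      e ∘ orbitProj G N = orbitProj G (MulAction.orbitRel.Quotient K N) ∘ orbitProj K N →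
        IsDDiffeomorphism e) ∧
    (∀ k : ℕ, Set.BijOn (orbitPullback K N k)
      (Set.range (orbitPullback G (MulAction.orbitRel.Quotient K N) k))
      (Set.range (orbitPullback G N k))) ∧
    (ActsProperly (N := N) ι → HasConstantOrbitType N ι → ∀ k : ℕ,
      Set.BijOn (orbitPullback K N k)
        (basicForms EG G (MulAction.orbitRel.Quotient K N) k) (basicForms EG G N k) ∧
      (Set.range (orbitPullback G (MulAction.orbitRel.Quotient K N) k) =
          basicForms EG G (MulAction.orbitRel.Quotient K N) k ↔
        Set.range (orbitPullback G N k) = basicForms EG G N k)) := by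
  refine ⟨existsUnique_stageMap K, fun e he => isDDiffeomorphism_stageMap K he,
    bijOn_range_orbitPullback K, fun _ _ k => ?_⟩
  have hbasic := bijOn_basicForms_orbitPullback (EG := EG) (N := N) K EN k
  refine ⟨hbasic, ?_⟩
  -- Both sets on `N` are images under the injective `π_K^*` of the corresponding sets on `N/K`.
  rw [← (bijOn_range_orbitPullback (N := N) K k).image_eq, ← hbasic.image_eq]
  exact (orbitPullback_injective K N k).image_injective.eq_iff.symm
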